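/- Work in second-order arithmetic with base theory $\mathsf{RCA}_0$: the basic axioms for $0,1,+,\times,<$, the $\Sigma^0_1$ induction scheme, and the $\Delta^0_1$ comprehension scheme. Let $\mathbb{N}$ denote the (possibly nonstandard) first-order part; for a standard natural number $k$, $k^{<\mathbb{N}}$ is the set of (codes of) finite strings with entries $<k$, and a tree $T\subseteq k^{<\mathbb{N}}$ is a set of strings closed under prefixes. A set $H\subseteq\mathbb{N}$ is homogeneous for a string $\sigma\in k^{<\mathbb{N}}$ if $(\exists c<k)(\forall i\in H)(i<|\sigma|\rightarrow\sigma(i)=c)$, and $H$ is homogeneous for an infinite tree $T\subseteq k^{<\mathbb{N}}$ if $\{\sigma\in T : H\text{ is homogeneous for }\sigma\}$ is infinite. Let - $\mathsf{RWKL}_k$ be the statement "for every infinite tree $T\subseteq k^{<\mathbb{N}}$ there is an infinite $H\subseteq\mathbb{N}$ that is homogeneous for $T$"; - $\mathsf{LRWKL}_k$ be the statement "for every infinite tree $T\subseteq k^{<\mathbb{N}}$ and every infinite $X\subseteq\mathbb{N}$ there is an infinite $H\subseteq X$ that is homogeneous for $T$"; - $\mathsf{RWKL}$ and $\mathsf{LRWKL}$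 be $\mathsf{RWKL}_2$ and $\mathsf{LRWKL}_2$. **Theorem.** For every standard natural number $k\ge 2$, the statements (i) $\mathsf{RWKL}$, (ii) $\mathsf{LRWKL}$, (iii) $\mathsf{RWKL}_k$, (iv) $\mathsf{LRWKL}_k$ are pairwise equivalent over $\mathsf{RCA}_0$; that is, for any two of them, $\mathsf{RCA}_0$ proves that they are equivalent (or, what is the same by the completeness theorem, they are equivalent in every model of $\mathsf{RCA}_0$, with an arbitrary, possibly nonstandard, first-order part $\mathbb{N}$ and an arbitrary collection of subsets of $\mathbb{N}$ as second-order part). -/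

import Mathlib

universe u

/-! The language of second-order arithmetic, with de Bruijn indices: a formula in `Formula n m` has
its free number variables among `0, …, n - 1` and its free set variables among `0, …, m - 1`;
a quantifier binds variable `0` of its sort and shifts the other variables of that sort by one. -/

namespace SecondOrderArithmetic

/-- Number terms with free variables among `0, …, n - 1`. -/
inductive Term (n : ℕ) : Type
  | var (i : Fin n) : Term n
  | zero : Term n
  | one : Term n
  | add (s t : Term n) : Term n
  | mul (s t : Term n) : Term n

/-- Formulas of second-order arithmetic. -/
inductive Formula : ℕ → ℕ → Type
  | falsum {n m : ℕ} : Formula n m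
  | eq {n m : ℕ} (s t : Term n) : Formula n m
  | lt {n m : ℕ} (s t : Term n) : Formula n m
  | mem {n m : ℕ} (t : Term n) (X : Fin m) : Formula n m
  | imp {n m : ℕ} (φ ψ : Formula n m) : Formula n m
  | all {n m : ℕ} (φ : Formula (n + 1) m) : Formula n m
  | allSet {n m : ℕ} (φ : Formula n (m + 1)) : Formula n m

/-- A sentence is a formula without free variables. -/
abbrev Sentence : Type := Formula 0 0

namespace Term

/-- Simultaneous substitution of terms for variables. -/
def subst {n n' : ℕ} (σ : Fin n → Term n') : Term n → Term n'
  | var i => σ i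
  | zero => zero
  | one => one
  | add s t => add (s.subst σ) (t.subst σ)
  | mul s t => mul (s.subst σ) (t.subst σ)

/-- The same term, read under one more number quantifier. -/
def up {n : ℕ} (t : Term n) : Term (n + 1) := t.subst fun i => var i.succ

/-- The numeral `0 + 1 + ⋯ + 1` of a standard natural number. -/
def numeral {n : ℕ} : ℕ → Term n
  | 0 => zero
  | k + 1 => add (numeral k) one

/-- The pairing function `⟨s, t⟩ = (s + t)² + s`. -/
def pair {n : ℕ} (s t : Term n) : Term n := add (mul (add s t) (add s t)) s

end Term

namespace Formula

def neg {n m : ℕ} (φ : Formula n m) : Formula n m := imp φ falsum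

def and {n m : ℕ} (φ ψ : Formula n m) : Formula n m := neg (imp φ (neg ψ))

def or {n m : ℕ} (φ ψ : Formula n m) : Formula n m := imp (neg φ) ψ

def iff {n m : ℕ} (φ ψ : Formula n m) : Formula n m := and (imp φ ψ) (imp ψ φ)

def ex {n m : ℕ} (φ : Formula (n + 1) m) : Formula n m := neg (all (neg φ))

def exSet {n m : ℕ} (φ : Formula n (m + 1)) : Formula n m := neg (allSet (neg φ))

/-- The bounded quantifier `∀ x < t, φ`; the variable `x` does not occur in `t`. -/
def allLt {n m : ℕ} (t : Term n) (φ : Formula (n + 1) m) : Formula n m :=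
  all (imp (lt (.var 0) t.up) φ)

/-- The bounded quantifier `∃ x < t, φ`. -/
def exLt {n m : ℕ} (t : Term n) (φ : Formula (n + 1) m) : Formula n m :=
  ex (and (lt (.var 0) t.up) φ)

/-- Simultaneous capture-avoiding substitution of number terms for number variables and of
set variables for set variables. -/
def subst : {n m n' m' : ℕ} → (Fin n → Term n') → (Fin m → Fin m') → Formula n m → Formula n' m'
  | _, _, _, _, _, _, falsum => falsum
  | _, _, _, _, σ, _, eq s t => eq (s.subst σ) (t.subst σ)
  | _, _, _, _, σ, _, lt s t => lt (s.subst σ) (t.subst σ)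
  | _, _, _, _, σ, τ, mem t X => mem (t.subst σ) (τ X)
  | _, _, _, _, σ, τ, imp φ ψ => imp (φ.subst σ τ) (ψ.subst σ τ)
  | _, _, _, _, σ, τ, all φ => all (φ.subst (Fin.cons (.var 0) fun i => (σ i).up) τ)
  | _, _, _, _, σ, τ, allSet φ => allSet (φ.subst σ (Fin.cons 0 fun X => (τ X).succ))

/-- The same formula, read under one more set quantifier (whose variable is not free in it). -/
def upSet {n m : ℕ} (φ : Formula n m) : Formula n (m + 1) := φ.subst .var Fin.succ

/-- `φ(0)`, where `φ = φ(x)` and `x` is number variable `0`. -/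
def atZero {n m : ℕ} (φ : Formula (n + 1) m) : Formula n m :=
  φ.subst (Fin.cons .zero .var) id

/-- `φ(x + 1)`, where `φ = φ(x)` and `x` is number variable `0`. -/
def atSucc {n m : ℕ} (φ : Formula (n + 1) m) : Formula (n + 1) m :=
  φ.subst (Fin.cons (.add (.var 0) .one) fun i => .var i.succ) id

/-- Universal closure over the number variables. -/
def closeNum {m : ℕ} : {n : ℕ} → Formula n m → Formula 0 m
  | 0, φ => φ
  | _ + 1, φ => closeNum (all φ)

/-- Universal closure over the set variables. -/
def closeSet : {m : ℕ} → Formula 0 m → Sentence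
  | 0, φ => φ
  | _ + 1, φ => closeSet (allSet φ)

/-- Universal closure. -/
def close {n m : ℕ} (φ : Formula n m) : Sentence := φ.closeNum.closeSet

/-- Bounded-quantifier formulas (set variables may occur free). Bounded existential
quantifiers and the other connectives are expressed by the ones listed, since
`∃ x < t, φ` is equivalent to `¬ ∀ x < t, ¬ φ`. -/
inductive IsDelta0 : {n m : ℕ} → Formula n m → Prop
  | falsum {n m : ℕ} : IsDelta0 (falsum : Formula n m)
  | eq {n m : ℕ} (s t : Term n) : IsDelta0 (eq s t : Formula n m)
  | lt {n m : ℕ} (s t : Term n) : IsDelta0 (lt s t : Formula n m)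
  | mem {n m : ℕ} (t : Term n) (X : Fin m) : IsDelta0 (mem t X)
  | imp {n m : ℕ} {φ ψ : Formula n m} : IsDelta0 φ → IsDelta0 ψ → IsDelta0 (imp φ ψ)
  | allLt {n m : ℕ} (t : Term n) {φ : Formula (n + 1) m} : IsDelta0 φ → IsDelta0 (allLt t φ)

/-- `Σ⁰₁` formulas: `∃ x θ` with `θ` a bounded-quantifier formula. -/
def IsSigma1 {n m : ℕ} (φ : Formula n m) : Prop := ∃ θ : Formula (n + 1) m, θ.IsDelta0 ∧ φ = ex θ

/-- `Π⁰₁` formulas: `∀ x θ` with `θ` a bounded-quantifier formula. -/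
def IsPi1 {n m : ℕ} (φ : Formula n m) : Prop := ∃ θ : Formula (n + 1) m, θ.IsDelta0 ∧ φ = all θ

end Formula

open Formula in
/-- The basic axioms. In the two-variable axioms `m` is variable `1` and `n` is variable `0`. -/
inductive BasicAxiom : Sentence → Prop
  | succ_ne_zero : BasicAxiom (all (neg (eq (.add (.var 0) .one) .zero)))
  | succ_inj : BasicAxiom (all (all (imp (eq (.add (.var 1) .one) (.add (.var 0) .one))
      (eq (.var 1) (.var 0)))))
  | add_zero : BasicAxiom (all (eq (.add (.var 0) .zero) (.var 0)))
  | add_succ : BasicAxiom (all (all (eq (.add (.var 1) (.add (.var 0) .one))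
      (.add (.add (.var 1) (.var 0)) .one))))
  | mul_zero : BasicAxiom (all (eq (.mul (.var 0) .zero) .zero))
  | mul_succ : BasicAxiom (all (all (eq (.mul (.var 1) (.add (.var 0) .one))
      (.add (.mul (.var 1) (.var 0)) (.var 1)))))
  | not_lt_zero : BasicAxiom (all (neg (lt (.var 0) .zero)))
  | lt_succ : BasicAxiom (all (all (iff (lt (.var 1) (.add (.var 0) .one))
      (or (lt (.var 1) (.var 0)) (eq (.var 1) (.var 0))))))

/-- Universal closure of `[φ(0) ∧ ∀ x (φ(x) → φ(x + 1))] → ∀ x φ(x)`. -/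
def inductionAxiom {n m : ℕ} (φ : Formula (n + 1) m) : Sentence :=
  Formula.close (.imp (.and φ.atZero (.all (.imp φ φ.atSucc))) (.all φ))

/-- Universal closure of `∀ x (φ(x) ↔ ψ(x)) → ∃ X ∀ x (x ∈ X ↔ φ(x))`, `X` not free in `φ`. -/
def comprehensionAxiom {n m : ℕ} (φ ψ : Formula (n + 1) m) : Sentence :=
  Formula.close (.imp (.all (.iff φ ψ)) (.exSet (.all (.iff (.mem (.var 0) 0) φ.upSet))))

/-- The axioms of `RCA₀`: the basic axioms, the `Σ⁰₁` induction scheme and the `Δ⁰₁`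
comprehension scheme. -/
inductive RCA0 : Sentence → Prop
  | basic {φ : Sentence} : BasicAxiom φ → RCA0 φ
  | sigma1Induction {n m : ℕ} {φ : Formula (n + 1) m} : φ.IsSigma1 → RCA0 (inductionAxiom φ)
  | delta1Comprehension {n m : ℕ} {φ ψ : Formula (n + 1) m} :
      φ.IsSigma1 → ψ.IsPi1 → RCA0 (comprehensionAxiom φ ψ)

/-- A structure for the language of second-order arithmetic, in general (Henkin) semantics:
a possibly nonstandard first-order part and an arbitrary collection of its subsets, over which
the set quantifiers range. -/
structure Model where
  Num : Type u
  zero : Num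
  one : Num
  add : Num → Num → Num
  mul : Num → Num → Num
  lt : Num → Num → Prop
  sets : Set (Set Num)

/-- The value of a term. -/
def Term.val (M : Model.{u}) {n : ℕ} (v : Fin n → M.Num) : Term n → M.Num
  | var i => v i
  | zero => M.zero
  | one => M.one
  | add s t => M.add (s.val M v) (t.val M v)
  | mul s t => M.mul (s.val M v) (t.val M v)

/-- Satisfaction of a formula in a structure under an assignment of numbers and sets. -/
def Formula.Sat (M : Model.{u}) :
    {n m : ℕ} → (Fin n → M.Num) → (Fin m → M.sets) → Formula n m → Prop
  | _, _, _, _, falsum => False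
  | _, _, v, _, eq s t => s.val M v = t.val M v
  | _, _, v, _, lt s t => M.lt (s.val M v) (t.val M v)
  | _, _, v, V, mem t X => t.val M v ∈ (V X : Set M.Num)
  | _, _, v, V, imp φ ψ => φ.Sat M v V → ψ.Sat M v V
  | _, _, v, V, all φ => ∀ a : M.Num, φ.Sat M (Fin.cons a v) V
  | _, _, v, V, allSet φ => ∀ A : M.sets, φ.Sat M v (Fin.cons A V)

/-- Truth of a sentence in a structure. -/
def Model.Satisfies (M : Model.{u}) (φ : Sentence) : Prop := φ.Sat M Fin.elim0 Fin.elim0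

/-- `T` entails `φ`: every structure in which the axioms `T` are true, nonstandard structures
included, makes `φ` true. By the soundness and completeness theorems for (two-sorted) first-order
logic this is the same as `φ` being provable from `T`. -/
def Entails (T : Sentence → Prop) (φ : Sentence) : Prop :=
  ∀ M : Model.{u}, (∀ ψ : Sentence, T ψ → M.Satisfies ψ) → M.Satisfies φ

/-! Finite strings are coded by numbers with Gödel's `β` function: the number `⟨l, ⟨a, b⟩⟩`
represents the string of length `l` whose entry at `i < l` is the remainder of `a` modulo
`(i + 1) * b + 1`. The code of a string is the least number that represents it. -/

namespace Formula

/-- `s` represents a string of length `l`. -/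
def hasLength {n m : ℕ} (s l : Term n) : Formula n m :=
  -- `∃ a ∃ b, s = ⟨l, ⟨a, b⟩⟩`
  ex (ex (eq s.up.up (Term.pair l.up.up (Term.pair (.var 1) (.var 0)))))

/-- `s` represents a string whose entry at position `i` exists and equals `v`. -/
def hasEntry {n m : ℕ} (s i v : Term n) : Formula n m :=
  -- `∃ l ∃ a ∃ b ∃ q, s = ⟨l, ⟨a, b⟩⟩ ∧ i < l ∧ a = q * d + v ∧ v < d`, `d = (i + 1) * b + 1`
  let d : Term (n + 4) := .add (.mul (.add i.up.up.up.up .one) (.var 1)) .one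
  ex (ex (ex (ex (and (eq s.up.up.up.up (Term.pair (.var 3) (Term.pair (.var 2) (.var 1))))
    (and (lt i.up.up.up.up (.var 3))
      (and (eq (.var 2) (.add (.mul (.var 0) d) v.up.up.up.up)) (lt v.up.up.up.up d)))))))

/-- `s` and `t` represent the same string. -/
def sameString {n m : ℕ} (s t : Term n) : Formula n m :=
  -- `∃ l, |s| = l ∧ |t| = l ∧ ∀ i ∀ v, s(i) = v ↔ t(i) = v`
  and (ex (and (hasLength s.up (.var 0)) (hasLength t.up (.var 0))))
    (all (all (iff (hasEntry s.up.up (.var 1) (.var 0)) (hasEntry t.up.up (.var 1) (.var 0)))))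

/-- `s` is the code of a string. -/
def isString {n m : ℕ} (s : Term n) : Formula n m :=
  and (ex (hasLength s.up (.var 0))) (allLt s (neg (sameString (.var 0) s.up)))

/-- `s` is the code of a string in `k^{<ℕ}`. -/
def isStringOver {n m : ℕ} (k : ℕ) (s : Term n) : Formula n m :=
  -- every entry of `s` is less than `k`
  and (isString s)
    (all (all (imp (hasEntry s.up.up (.var 1) (.var 0)) (lt (.var 0) (Term.numeral k)))))

/-- The string `t` is a prefix of the string `s`. -/
def isPrefix {n m : ℕ} (t s : Term n) : Formula n m :=
  -- `∀ i ∀ v, t(i) = v → s(i) = v`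
  all (all (imp (hasEntry t.up.up (.var 1) (.var 0)) (hasEntry s.up.up (.var 1) (.var 0))))

/-- `T` is a tree contained in `k^{<ℕ}`. -/
def isTree {n m : ℕ} (k : ℕ) (T : Fin m) : Formula n m :=
  all (imp (mem (.var 0) T) (and (isStringOver k (.var 0))
    (all (imp (and (isString (.var 0)) (isPrefix (.var 0) (.var 1))) (mem (.var 0) T)))))

/-- `X` is infinite: `∀ x ∃ y, x < y ∧ y ∈ X`. -/
def infinite {n m : ℕ} (X : Fin m) : Formula n m :=
  all (ex (and (lt (.var 1) (.var 0)) (mem (.var 0) X)))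

/-- `H ⊆ X`. -/
def subset {n m : ℕ} (H X : Fin m) : Formula n m :=
  all (imp (mem (.var 0) H) (mem (.var 0) X))

/-- `H` is homogeneous for the string `s ∈ k^{<ℕ}`:
`∃ c < k, ∀ i ∈ H, i < |s| → s(i) = c`. -/
def homogeneousString {n m : ℕ} (k : ℕ) (H : Fin m) (s : Term n) : Formula n m :=
  exLt (Term.numeral k) (all (imp (mem (.var 0) H)
    (all (imp (hasEntry s.up.up.up (.var 1) (.var 0)) (eq (.var 0) (.var 2))))))

/-- `H` is homogeneous for the tree `T ⊆ k^{<ℕ}`: there are infinitely many `s ∈ T` such that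
`H` is homogeneous for `s`. -/
def homogeneousTree {n m : ℕ} (k : ℕ) (H T : Fin m) : Formula n m :=
  all (ex (and (lt (.var 1) (.var 0))
    (and (mem (.var 0) T) (homogeneousString k H (.var 0)))))

end Formula

open Formula in
/-- For every infinite tree `T ⊆ k^{<ℕ}` there is an infinite `H` that is homogeneous for `T`. -/
def RWKLk (k : ℕ) : Sentence :=
  -- under both quantifiers `T` is set variable `1` and `H` is set variable `0`
  allSet (imp (and (isTree k 0) (infinite 0))
    (exSet (and (infinite 0) (homogeneousTree k 0 1))))

open Formula in
/-- For every infinite tree `T ⊆ k^{<ℕ}` and every infinite `X` there is an infinite `H ⊆ X` that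
is homogeneous for `T`. -/
def LRWKLk (k : ℕ) : Sentence :=
  -- under all quantifiers `T` is set variable `2`, `X` is `1` and `H` is `0`
  allSet (allSet (imp (and (and (isTree k 1) (infinite 1)) (infinite 0))
    (exSet (and (infinite 0) (and (subset 0 1) (homogeneousTree k 0 2))))))

/-- Ramsey-type weak König's lemma. -/
def RWKL : Sentence := RWKLk 2

/-- Localized Ramsey-type weak König's lemma. -/
def LRWKL : Sentence := LRWKLk 2

end SecondOrderArithmetic

/-! The argument takes place inside an arbitrary model of $\mathsf{RCA}_0$, where each of the four
sentences is shown equivalent to $\mathsf{RWKL}_2$. Three observations carry it.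

Colors can be dropped (`rwkl_mono`): a tree over $j \le k$ colors is also a tree over $k$ colors.
Homogeneous sets can be localized (`lrwkl_of_rwkl`): given $X$, let the new string have at $i$ the
color of the old one at the least element of $X$ that is at least $i$; a homogeneous $H'$ for the
new tree yields the set of next elements in $X$ of members of $H'$. Colors can be added
(`lrwkl_succ`): $\mathsf{LRWKL}_2$ applied to "is the color $k$ or not" gives $H'$ on which either
$k$ is the only color, or $k$ is avoided by arbitrarily long strings; in the second case
$\mathsf{LRWKL}_k$ inside $H'$ finishes. Induction on the standard number $k$, outside the model,
then gives $\mathsf{LRWKL}_k$ from $\mathsf{LRWKL}_2$.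

All new trees come from one lemma, `IsTree.exists_related`: the strings over $J$ colors that are
related entrywise to a member of $T$ of the same length form a tree. As a set this is $\Delta^0_1$
only because the codes of strings of a given length are bounded (`StrBound.le`). That bound rests on
the Chinese remainder theorem (`exists_crt`), proved from $\Sigma^0_1$ induction after the ordered
semiring structure and the closure of $\Sigma^0_1$ under bounded quantification. -/

namespace SecondOrderArithmetic

/-! ### Semantics of the defined connectives and of substitution -/

section Semantics

variable {M : Model.{u}} {n m : ℕ} (v : Fin n → M.Num) (V : Fin m → M.sets)

theorem Term.val_subst {n' : ℕ} (σ : Fin n → Term n') (v : Fin n' → M.Num) (t : Term n) :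
    (t.subst σ).val M v = t.val M fun i => (σ i).val M v := by
  induction t <;> simp_all [Term.subst, Term.val]

theorem Term.val_up (a : M.Num) (t : Term n) :
    t.up.val M (Fin.cons a v : Fin (n + 1) → M.Num) = t.val M v := by
  simp [Term.up, Term.val_subst, Term.val]

theorem Formula.sat_subst {n' m' : ℕ} (σ : Fin n → Term n') (τ : Fin m → Fin m')
    (v : Fin n' → M.Num) (V : Fin m' → M.sets) (φ : Formula n m) :
    (φ.subst σ τ).Sat M v V ↔ φ.Sat M (fun i => (σ i).val M v) fun X => V (τ X) := by
  induction φ generalizing n' m' with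
  | falsum => simp [Formula.subst, Formula.Sat]
  | eq s t => simp [Formula.subst, Formula.Sat, Term.val_subst]
  | lt s t => simp [Formula.subst, Formula.Sat, Term.val_subst]
  | mem t X => simp [Formula.subst, Formula.Sat, Term.val_subst]
  | imp φ ψ ihφ ihψ => simp [Formula.subst, Formula.Sat, ihφ, ihψ]
  | all φ ih =>
    simp only [Formula.subst, Formula.Sat, ih]
    refine forall_congr' fun a => ?_
    have : (fun i => ((Fin.cons (.var 0) fun i => (σ i).up : Fin (_ + 1) → Term (n' + 1)) i).val M
        (Fin.cons a v : Fin (n' + 1) → M.Num)) = Fin.cons a fun i => (σ i).val M v := by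
      funext i
      refine Fin.cases ?_ (fun j => ?_) i <;> simp [Term.val, Term.val_up]
    rw [this]
  | allSet φ ih =>
    simp only [Formula.subst, Formula.Sat, ih]
    refine forall_congr' fun A => ?_
    have : (fun X => (Fin.cons A V : Fin (m' + 1) → M.sets)
        ((Fin.cons 0 fun X => (τ X).succ : Fin (_ + 1) → Fin (m' + 1)) X))
          = Fin.cons A fun X => V (τ X) := by
      funext i
      refine Fin.cases ?_ (fun j => ?_) i <;> simp
    rw [this]

open Formula

theorem Formula.sat_neg (φ : Formula n m) : φ.neg.Sat M v V ↔ ¬ φ.Sat M v V := Iff.rfl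

theorem Formula.sat_and (φ ψ : Formula n m) :
    (φ.and ψ).Sat M v V ↔ φ.Sat M v V ∧ ψ.Sat M v V := by
  simp [Formula.and, Formula.neg, Formula.Sat]

theorem Formula.sat_or (φ ψ : Formula n m) :
    (φ.or ψ).Sat M v V ↔ φ.Sat M v V ∨ ψ.Sat M v V := by
  simp [Formula.or, Formula.neg, Formula.Sat, or_iff_not_imp_left]

theorem Formula.sat_iff (φ ψ : Formula n m) :
    (φ.iff ψ).Sat M v V ↔ (φ.Sat M v V ↔ ψ.Sat M v V) := by
  simp only [Formula.iff, Formula.sat_and, Formula.Sat, iff_def]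

theorem Formula.sat_ex (φ : Formula (n + 1) m) :
    φ.ex.Sat M v V ↔ ∃ a, φ.Sat M (Fin.cons a v) V := by
  simp [Formula.ex, Formula.neg, Formula.Sat]

theorem Formula.sat_exSet (φ : Formula n (m + 1)) :
    φ.exSet.Sat M v V ↔ ∃ A, φ.Sat M v (Fin.cons A V) := by
  simp [Formula.exSet, Formula.neg, Formula.Sat]

theorem Formula.sat_allLt (t : Term n) (φ : Formula (n + 1) m) :
    (φ.allLt t).Sat M v V ↔ ∀ a, M.lt a (t.val M v) → φ.Sat M (Fin.cons a v) V := by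
  simp [Formula.allLt, Formula.Sat, Term.val, Term.val_up]

theorem Formula.sat_exLt (t : Term n) (φ : Formula (n + 1) m) :
    (φ.exLt t).Sat M v V ↔ ∃ a, M.lt a (t.val M v) ∧ φ.Sat M (Fin.cons a v) V := by
  simp [Formula.exLt, Formula.sat_ex, Formula.sat_and, Formula.Sat, Term.val, Term.val_up]

theorem Formula.sat_upSet (A : M.sets) (φ : Formula n m) :
    φ.upSet.Sat M v (Fin.cons A V : Fin (m + 1) → M.sets) ↔ φ.Sat M v V := by
  simp [Formula.upSet, Formula.sat_subst, Term.val]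

theorem Formula.sat_atZero (φ : Formula (n + 1) m) :
    φ.atZero.Sat M v V ↔ φ.Sat M (Fin.cons M.zero v) V := by
  have : (fun i => ((Fin.cons .zero .var : Fin (n + 1) → Term n) i).val M v) =
      Fin.cons M.zero v := by
    funext i
    refine Fin.cases ?_ (fun j => ?_) i <;> simp [Term.val]
  simp [Formula.atZero, Formula.sat_subst, this]

theorem Formula.sat_atSucc (a : M.Num) (φ : Formula (n + 1) m) :
    φ.atSucc.Sat M (Fin.cons a v) V ↔ φ.Sat M (Fin.cons (M.add a M.one) v) V := by
  have : (fun i => ((Fin.cons (.add (.var 0) .one) fun i => .var i.succ :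
      Fin (n + 1) → Term (n + 1)) i).val M (Fin.cons a v : Fin (n + 1) → M.Num)) =
      Fin.cons (M.add a M.one) v := by
    funext i
    refine Fin.cases ?_ (fun j => ?_) i <;> simp [Term.val]
  simp [Formula.atSucc, Formula.sat_subst, this]

theorem Formula.sat_closeNum {n : ℕ} (φ : Formula n m) (w : Fin 0 → M.Num) :
    φ.closeNum.Sat M w V ↔ ∀ v, φ.Sat M v V := by
  induction n with
  | zero =>
    refine ⟨fun h v => ?_, fun h => h w⟩
    rwa [Subsingleton.elim v w]
  | succ n ih =>
    rw [Formula.closeNum, ih]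
    simp only [Formula.Sat]
    exact ⟨fun h v => Fin.cons_self_tail v ▸ h _ _, fun h v a => h _⟩

theorem Formula.sat_closeSet {m : ℕ} (φ : Formula 0 m) (w : Fin 0 → M.Num) (W : Fin 0 → M.sets) :
    φ.closeSet.Sat M w W ↔ ∀ V, φ.Sat M w V := by
  induction m with
  | zero =>
    refine ⟨fun h v => ?_, fun h => h W⟩
    rwa [Subsingleton.elim v W]
  | succ m ih =>
    rw [Formula.closeSet, ih]
    simp only [Formula.Sat]
    exact ⟨fun h v => Fin.cons_self_tail v ▸ h _ _, fun h v a => h _⟩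

theorem Model.satisfies_close (φ : Formula n m) :
    M.Satisfies φ.close ↔ ∀ V v, φ.Sat M v V := by
  simp [Model.Satisfies, Formula.close, Formula.sat_closeSet, Formula.sat_closeNum]

end Semantics

/-! ### Definable relations

Relations on the numbers of a model are presented as predicates on assignments `ℕ → M.Num`, so that
instance search can establish their definability. -/

section Definability

variable {M : Model.{u}}

instance : Zero M.Num := ⟨M.zero⟩
instance : One M.Num := ⟨M.one⟩
instance : Add M.Num := ⟨M.add⟩
instance : Mul M.Num := ⟨M.mul⟩
instance : LT M.Num := ⟨M.lt⟩

/-- Values of terms with parameters. -/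
class inductive PolyFn : ((ℕ → M.Num) → M.Num) → Prop
  | var (i : ℕ) : PolyFn fun v => v i
  | const (a : M.Num) : PolyFn fun _ => a
  | add {f g} : PolyFn f → PolyFn g → PolyFn fun v => f v + g v
  | mul {f g} : PolyFn f → PolyFn g → PolyFn fun v => f v * g v

/-- Relations defined by bounded-quantifier formulas with parameters. -/
class inductive Delta0 : ((ℕ → M.Num) → Prop) → Prop
  | falsum : Delta0 fun _ => False
  | eq {f g} : PolyFn f → PolyFn g → Delta0 fun v => f v = g v
  | lt {f g} : PolyFn f → PolyFn g → Delta0 fun v => f v < g v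
  | mem {f} (A : M.sets) : PolyFn f → Delta0 fun v => f v ∈ (A : Set M.Num)
  | imp {P Q} : Delta0 P → Delta0 Q → Delta0 fun v => P v → Q v
  | ball {f} {P : M.Num → (ℕ → M.Num) → Prop} : PolyFn f →
      Delta0 (fun v => P (v 0) fun i => v (i + 1)) → Delta0 fun v => ∀ x, x < f v → P x v

/-- Relations defined by `Σ⁰₁` formulas with parameters. -/
class Sigma1 (P : (ℕ → M.Num) → Prop) : Prop where
  out : ∃ Q : M.Num → (ℕ → M.Num) → Prop,
    Delta0 (fun v => Q (v 0) fun i => v (i + 1)) ∧ ∀ v, P v ↔ ∃ x, Q x v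

variable (f g : (ℕ → M.Num) → M.Num) (P Q : (ℕ → M.Num) → Prop)
  (R : M.Num → (ℕ → M.Num) → Prop)

instance (i : ℕ) : PolyFn fun v : ℕ → M.Num => v i := .var i
instance (a : M.Num) : PolyFn fun _ : ℕ → M.Num => a := .const a
instance [hf : PolyFn f] [hg : PolyFn g] : PolyFn fun v => f v + g v := .add hf hg
instance [hf : PolyFn f] [hg : PolyFn g] : PolyFn fun v => f v * g v := .mul hf hg

instance [hf : PolyFn f] [hg : PolyFn g] : Delta0 fun v => f v = g v := .eq hf hg
instance [hf : PolyFn f] [hg : PolyFn g] : Delta0 fun v => f v < g v := .lt hf hg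
instance (A : M.sets) [hf : PolyFn f] : Delta0 fun v => f v ∈ (A : Set M.Num) := .mem A hf
instance [hP : Delta0 P] [hQ : Delta0 Q] : Delta0 fun v => P v → Q v := .imp hP hQ
instance [hf : PolyFn f] [hR : Delta0 fun v => R (v 0) fun i => v (i + 1)] :
    Delta0 fun v => ∀ x, x < f v → R x v := .ball hf hR
instance : Delta0 fun _ : ℕ → M.Num => False := .falsum

theorem Delta0.congr {P : (ℕ → M.Num) → Prop} (Q : (ℕ → M.Num) → Prop) [hQ : Delta0 Q]
    (h : ∀ v, P v ↔ Q v) : Delta0 P := by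
  rwa [funext fun v => propext (h v)]

instance [Delta0 P] : Delta0 fun v => ¬ P v := .congr (fun v => P v → False) fun _ => Iff.rfl
instance [Delta0 P] [Delta0 Q] : Delta0 fun v => P v ∧ Q v :=
  .congr (fun v => ¬ (P v → ¬ Q v)) fun _ => by simp
instance [Delta0 P] [Delta0 Q] : Delta0 fun v => P v ∨ Q v :=
  .congr (fun v => ¬ P v → Q v) fun _ => or_iff_not_imp_left
instance [Delta0 P] [Delta0 Q] : Delta0 fun v => P v ↔ Q v :=
  .congr (fun v => (P v → Q v) ∧ (Q v → P v)) fun _ => iff_def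
instance [PolyFn f] [hR : Delta0 fun v => R (v 0) fun i => v (i + 1)] :
    Delta0 fun v => ∃ x, x < f v ∧ R x v :=
  .congr (fun v => ¬ ∀ x, x < f v → ¬ R x v) fun _ => by simp
instance : Delta0 fun _ : ℕ → M.Num => True := .congr (fun _ => ¬ False) fun _ => by simp

variable {f g P Q R}

theorem PolyFn.comp (hf : PolyFn f) (s : (ℕ → M.Num) → ℕ → M.Num)
    (hs : ∀ i, PolyFn fun v => s v i) :
    PolyFn fun v => f (s v) := by
  induction hf with
  | var i => exact hs i
  | const a => exact .const a
  | add _ _ ih₁ ih₂ => exact .add ih₁ ih₂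
  | mul _ _ ih₁ ih₂ => exact .mul ih₁ ih₂

/-- Definability need only be checked with variables as arguments; substitution then allows
arbitrary polynomial arguments, or the variables in another order. -/
theorem Delta0.comp (hP : Delta0 P) (s : (ℕ → M.Num) → ℕ → M.Num)
    (hs : ∀ i, PolyFn fun v => s v i) : Delta0 fun v => P (s v) := by
  induction hP generalizing s with
  | falsum => exact .falsum
  | eq hf hg => exact .eq (hf.comp s hs) (hg.comp s hs)
  | lt hf hg => exact .lt (hf.comp s hs) (hg.comp s hs)
  | mem A hf => exact .mem A (hf.comp s hs)
  | imp _ _ ih₁ ih₂ => exact .imp (ih₁ s hs) (ih₂ s hs)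
  | ball hf _ ih =>
    refine .ball (hf.comp s hs)
      (ih (fun v i => Nat.casesOn i (v 0) fun j => s (fun i => v (i + 1)) j)
      fun i => ?_)
    cases i with
    | zero => exact .var 0
    | succ j => exact (hs j).comp (fun v i => v (i + 1)) fun i => .var (i + 1)

/-- The assignment `x, v 0, v 1, …`. -/
def scons (x : M.Num) (v : ℕ → M.Num) (i : ℕ) : M.Num := Nat.casesOn i x v

theorem Delta0.comp₂ {R : M.Num → M.Num → Prop} (h : Delta0 fun v => R (v 0) (v 1))
    (hf : PolyFn f) (hg : PolyFn g) : Delta0 fun v => R (f v) (g v) :=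
  h.comp (fun v => scons (f v) fun _ => g v) fun i => by cases i <;> assumption

theorem Delta0.comp₃ {R : M.Num → M.Num → M.Num → Prop} {h : (ℕ → M.Num) → M.Num}
    (hR : Delta0 fun v => R (v 0) (v 1) (v 2))
    (hf : PolyFn f) (hg : PolyFn g) (hh : PolyFn h) : Delta0 fun v => R (f v) (g v) (h v) :=
  hR.comp (fun v => scons (f v) (scons (g v) fun _ => h v)) fun i => by
    rcases i with _ | _ | i <;> assumption

theorem Delta0.comp₄ {R : M.Num → M.Num → M.Num → M.Num → Prop} {h k : (ℕ → M.Num) → M.Num}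
    (hR : Delta0 fun v => R (v 0) (v 1) (v 2) (v 3))
    (hf : PolyFn f) (hg : PolyFn g) (hh : PolyFn h) (hk : PolyFn k) :
    Delta0 fun v => R (f v) (g v) (h v) (k v) :=
  hR.comp (fun v => scons (f v) (scons (g v) (scons (h v) fun _ => k v))) fun i => by
    rcases i with _ | _ | _ | i <;> assumption

/-- `N` bounds the variables that occur and `F` collects the parameters. The places `ι`, `κ` of both
among the `n` variables of the term stay arbitrary, so that they can be shifted when a quantifier is
passed and shared between two relations. -/
theorem PolyFn.exists_term (hf : PolyFn f) : ∃ (N : ℕ) (F : Finset M.Num),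
    ∀ (n : ℕ) (ι : ℕ → Fin n) (κ : M.Num → Fin n), ∃ t : Term n,
      ∀ (v : ℕ → M.Num) (w : Fin n → M.Num), (∀ i < N, w (ι i) = v i) → (∀ c ∈ F, w (κ c) = c) →
        t.val M w = f v := by
  classical
  induction hf with
  | var i => exact ⟨i + 1, ∅, fun n ι κ => ⟨.var (ι i), fun v w hv _ => hv i i.lt_succ_self⟩⟩
  | const a => exact ⟨0, {a}, fun n ι κ => ⟨.var (κ a), fun v w _ hF => hF a (by simp)⟩⟩
  | add _ _ ih₁ ih₂ =>
    obtain ⟨N₁, F₁, h₁⟩ := ih₁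
    obtain ⟨N₂, F₂, h₂⟩ := ih₂
    refine ⟨max N₁ N₂, F₁ ∪ F₂, fun n ι κ => ?_⟩
    obtain ⟨t₁, h₁⟩ := h₁ n ι κ
    obtain ⟨t₂, h₂⟩ := h₂ n ι κ
    refine ⟨.add t₁ t₂, fun v w hv hF => ?_⟩
    rw [Term.val, h₁ v w (fun i hi => hv i (by omega)) fun c hc => hF c (by simp [hc]),
      h₂ v w (fun i hi => hv i (by omega)) fun c hc => hF c (by simp [hc])]
    rfl
  | mul _ _ ih₁ ih₂ =>
    obtain ⟨N₁, F₁, h₁⟩ := ih₁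
    obtain ⟨N₂, F₂, h₂⟩ := ih₂
    refine ⟨max N₁ N₂, F₁ ∪ F₂, fun n ι κ => ?_⟩
    obtain ⟨t₁, h₁⟩ := h₁ n ι κ
    obtain ⟨t₂, h₂⟩ := h₂ n ι κ
    refine ⟨.mul t₁ t₂, fun v w hv hF => ?_⟩
    rw [Term.val, h₁ v w (fun i hi => hv i (by omega)) fun c hc => hF c (by simp [hc]),
      h₂ v w (fun i hi => hv i (by omega)) fun c hc => hF c (by simp [hc])]
    rfl

theorem Delta0.exists_formula (hP : Delta0 P) : ∃ (N : ℕ) (F : Finset M.Num) (G : Finset M.sets),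
    ∀ (n m : ℕ) (ι : ℕ → Fin n) (κ : M.Num → Fin n) (V : Fin m → M.sets),
      (∀ A ∈ G, ∃ j, V j = A) → ∃ φ : Formula n m, φ.IsDelta0 ∧
        ∀ (v : ℕ → M.Num) (w : Fin n → M.Num), (∀ i < N, w (ι i) = v i) →
          (∀ c ∈ F, w (κ c) = c) → (φ.Sat M w V ↔ P v) := by
  classical
  induction hP with
  | falsum => exact ⟨0, ∅, ∅, fun _ _ _ _ _ _ => ⟨_, .falsum, fun _ _ _ _ => Iff.rfl⟩⟩
  | eq hf hg =>
    obtain ⟨N₁, F₁, h₁⟩ := hf.exists_term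
    obtain ⟨N₂, F₂, h₂⟩ := hg.exists_term
    refine ⟨max N₁ N₂, F₁ ∪ F₂, ∅, fun n m ι κ V _ => ?_⟩
    obtain ⟨t₁, h₁⟩ := h₁ n ι κ
    obtain ⟨t₂, h₂⟩ := h₂ n ι κ
    refine ⟨_, .eq t₁ t₂, fun v w hv hF => ?_⟩
    rw [Formula.Sat, h₁ v w (fun i hi => hv i (by omega)) fun c hc => hF c (by simp [hc]),
      h₂ v w (fun i hi => hv i (by omega)) fun c hc => hF c (by simp [hc])]
  | lt hf hg =>
    obtain ⟨N₁, F₁, h₁⟩ := hf.exists_term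
    obtain ⟨N₂, F₂, h₂⟩ := hg.exists_term
    refine ⟨max N₁ N₂, F₁ ∪ F₂, ∅, fun n m ι κ V _ => ?_⟩
    obtain ⟨t₁, h₁⟩ := h₁ n ι κ
    obtain ⟨t₂, h₂⟩ := h₂ n ι κ
    refine ⟨_, .lt t₁ t₂, fun v w hv hF => ?_⟩
    rw [Formula.Sat, h₁ v w (fun i hi => hv i (by omega)) fun c hc => hF c (by simp [hc]),
      h₂ v w (fun i hi => hv i (by omega)) fun c hc => hF c (by simp [hc])]
    rfl
  | mem A hf =>
    obtain ⟨N, F, h⟩ := hf.exists_term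
    refine ⟨N, F, {A}, fun n m ι κ V hV => ?_⟩
    obtain ⟨j, hj⟩ := hV A (by simp)
    obtain ⟨t, h⟩ := h n ι κ
    refine ⟨_, .mem t j, fun v w hv hF => ?_⟩
    rw [Formula.Sat, h v w hv hF, hj]
  | imp _ _ ih₁ ih₂ =>
    obtain ⟨N₁, F₁, G₁, h₁⟩ := ih₁
    obtain ⟨N₂, F₂, G₂, h₂⟩ := ih₂
    refine ⟨max N₁ N₂, F₁ ∪ F₂, G₁ ∪ G₂, fun n m ι κ V hV => ?_⟩
    obtain ⟨φ₁, hφ₁, h₁⟩ := h₁ n m ι κ V fun A hA => hV A (by simp [hA])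
    obtain ⟨φ₂, hφ₂, h₂⟩ := h₂ n m ι κ V fun A hA => hV A (by simp [hA])
    refine ⟨_, .imp hφ₁ hφ₂, fun v w hv hF => ?_⟩
    rw [Formula.Sat, h₁ v w (fun i hi => hv i (by omega)) fun c hc => hF c (by simp [hc]),
      h₂ v w (fun i hi => hv i (by omega)) fun c hc => hF c (by simp [hc])]
  | ball hf _ ih =>
    obtain ⟨N₁, F₁, h₁⟩ := hf.exists_term
    obtain ⟨N₂, F₂, G, h₂⟩ := ih
    refine ⟨max N₁ N₂, F₁ ∪ F₂, G, fun n m ι κ V hV => ?_⟩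
    obtain ⟨t, h₁⟩ := h₁ n ι κ
    -- The bound variable takes place `0`; all other variables and the parameters move up by one.
    obtain ⟨φ, hφ, h₂⟩ := h₂ (n + 1) m (fun i => Nat.casesOn i 0 fun j => (ι j).succ)
      (fun c => (κ c).succ) V hV
    refine ⟨_, .allLt t hφ, fun v w hv hF => ?_⟩
    rw [Formula.sat_allLt, h₁ v w (fun i hi => hv i (by omega)) fun c hc => hF c (by simp [hc])]
    refine forall_congr' fun a => imp_congr Iff.rfl ?_
    rw [h₂ (scons a v) (Fin.cons a w) (fun i hi => ?_) fun c hc => ?_]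
    · rfl
    · cases i with
      | zero => rfl
      | succ j => exact hv j (by omega)
    · simpa using hF c (by simp [hc])

theorem Sigma1.congr (Q : (ℕ → M.Num) → Prop) [hQ : Sigma1 Q] (h : ∀ v, P v ↔ Q v) :
    Sigma1 P := by
  rwa [funext fun v => propext (h v)]

/-- Two `Δ⁰₀` relations are defined by formulas with the same parameters. -/
theorem Delta0.exists_formula₂ {R S : M.Num → M.Num → Prop} (hR : Delta0 fun v => R (v 0) (v 1))
    (hS : Delta0 fun v => S (v 0) (v 1)) :
    ∃ (n m : ℕ) (θ η : Formula (n + 2) m) (w : Fin n → M.Num) (V : Fin m → M.sets),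
      (θ.IsDelta0 ∧ ∀ x a, θ.Sat M (Fin.cons x (Fin.cons a w)) V ↔ R x a) ∧
      (η.IsDelta0 ∧ ∀ x a, η.Sat M (Fin.cons x (Fin.cons a w)) V ↔ S x a) := by
  classical
  obtain ⟨N₁, F₁, G₁, h₁⟩ := hR.exists_formula
  obtain ⟨N₂, F₂, G₂, h₂⟩ := hS.exists_formula
  set F := F₁ ∪ F₂ with hF
  set G := G₁ ∪ G₂ with hG
  let κ : M.Num → Fin (F.card + 2) := fun c =>
    if h : c ∈ F then (F.equivFin ⟨c, h⟩).succ.succ else 0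
  let ι : ℕ → Fin (F.card + 2) := fun i => Nat.casesOn i 0 fun _ => 1
  let V : Fin G.card → M.sets := fun j => G.equivFin.symm j
  have hV : ∀ A ∈ G, ∃ j, V j = A := fun A hA => ⟨G.equivFin ⟨A, hA⟩, by simp [V]⟩
  let w : Fin F.card → M.Num := fun i => F.equivFin.symm i
  have hw (x a : M.Num) : ∀ c ∈ F,
      (Fin.cons x (Fin.cons a w) : Fin (F.card + 2) → M.Num) (κ c) = c :=
    fun c hc => by simp [κ, hc, w]
  have hι (x a : M.Num) (i : ℕ) :
      (Fin.cons x (Fin.cons a w) : Fin (F.card + 2) → M.Num) (ι i) = scons x (fun _ => a) i := by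
    cases i <;> rfl
  obtain ⟨θ, hθ, h₁⟩ := h₁ _ _ ι κ V fun A hA => hV A (by simp [hG, hA])
  obtain ⟨η, hη, h₂⟩ := h₂ _ _ ι κ V fun A hA => hV A (by simp [hG, hA])
  exact ⟨_, _, θ, η, w, V,
    ⟨hθ, fun x a => h₁ _ _ (fun i _ => hι x a i) fun c hc => hw x a c (by simp [hF, hc])⟩,
    ⟨hη, fun x a => h₂ _ _ (fun i _ => hι x a i) fun c hc => hw x a c (by simp [hF, hc])⟩⟩

theorem Sigma1.exists_delta0 {P : M.Num → Prop} (hP : Sigma1 fun v => P (v 0)) :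
    ∃ R : M.Num → M.Num → Prop, Delta0 (fun v => R (v 0) (v 1)) ∧ ∀ a, P a ↔ ∃ x, R x a := by
  obtain ⟨Q, hQ, h⟩ := hP.out
  refine ⟨fun x a => Q x fun _ => a, ?_, fun a => h fun _ => a⟩
  refine hQ.comp (fun v => scons (v 0) fun _ => v 1) fun i => ?_
  cases i <;> exact .var _

end Definability

/-! ### Induction and comprehension in models of `RCA₀` -/

/-- Models of `RCA₀`. -/
class Model.IsRCA0 (M : Model.{u}) : Prop where
  satisfies : ∀ ψ, RCA0 ψ → M.Satisfies ψ

section Axioms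

variable {M : Model.{u}} [hM : M.IsRCA0]

theorem sigma1_induction (P : M.Num → Prop) [hP : Sigma1 fun v => P (v 0)]
    (zero : P 0) (succ : ∀ x, P x → P (x + 1)) (a : M.Num) : P a := by
  obtain ⟨R, hR, h⟩ := hP.exists_delta0
  obtain ⟨n, m, θ, -, w, V, ⟨hθ, hs⟩, -⟩ := hR.exists_formula₂ hR
  have := (Model.satisfies_close _).1 (hM.satisfies _ (.sigma1Induction ⟨θ, hθ, rfl⟩)) V w
  simp only [Formula.Sat, Formula.sat_and, Formula.sat_atZero, Formula.sat_atSucc,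
    Formula.sat_ex, hs, ← h] at this
  exact this ⟨zero, succ⟩ a

theorem delta1_comprehension (P : M.Num → Prop) [hP : Sigma1 fun v => P (v 0)]
    [hP' : Sigma1 fun v => ¬ P (v 0)] : ∃ A : M.sets, ∀ a, a ∈ (A : Set M.Num) ↔ P a := by
  obtain ⟨R, hR, h⟩ := hP.exists_delta0
  obtain ⟨S, hS, h'⟩ := Sigma1.exists_delta0 (P := fun a => ¬ P a) hP'
  obtain ⟨n, m, θ, η, w, V, ⟨hθ, hsθ⟩, ⟨hη, hsη⟩⟩ := hR.exists_formula₂ hS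
  have := (Model.satisfies_close _).1 (hM.satisfies _
    -- `∃ x, η` defines the complement of `P`, so `∀ x, ¬ η` is the required $\Pi^0_1$ definition of
    -- `P`.
    (.delta1Comprehension ⟨θ, hθ, rfl⟩ ⟨η.neg, .imp hη .falsum, rfl⟩)) V w
  simp only [Formula.Sat, Formula.sat_neg, Formula.sat_iff, Formula.sat_exSet, Formula.sat_upSet,
    Formula.sat_ex, hsθ, hsη, ← h, ← not_exists, ← h', not_not, Term.val, Fin.cons_zero] at this
  exact this fun _ => trivial

end Axioms


/-! ### The numbers of a model of `RCA₀` form an ordered semiring -/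

section Arithmetic

variable {M : Model.{u}}

instance (P : (ℕ → M.Num) → Prop) [hP : Delta0 P] : Sigma1 P :=
  ⟨fun _ => P, hP.comp (fun v i => v (i + 1)) fun i => .var (i + 1), fun _ => by
    simp⟩

theorem Sigma1.ex_delta0 (R : M.Num → (ℕ → M.Num) → Prop)
    (hR : Delta0 fun v => R (v 0) fun i => v (i + 1)) : Sigma1 fun v => ∃ x, R x v :=
  ⟨R, hR, fun _ => Iff.rfl⟩

namespace Number

variable [hM : M.IsRCA0]

theorem succ_ne_zero (a : M.Num) : a + 1 ≠ 0 :=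
  hM.satisfies _ (.basic .succ_ne_zero) a

theorem succ_inj {a b : M.Num} : a + 1 = b + 1 → a = b :=
  hM.satisfies _ (.basic .succ_inj) a b

protected theorem add_zero (a : M.Num) : a + 0 = a :=
  hM.satisfies _ (.basic .add_zero) a

theorem add_succ (a b : M.Num) : a + (b + 1) = a + b + 1 :=
  hM.satisfies _ (.basic .add_succ) a b

protected theorem mul_zero (a : M.Num) : a * 0 = 0 :=
  hM.satisfies _ (.basic .mul_zero) a

theorem mul_succ (a b : M.Num) : a * (b + 1) = a * b + a :=
  hM.satisfies _ (.basic .mul_succ) a b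

theorem not_lt_zero (a : M.Num) : ¬ a < 0 :=
  hM.satisfies _ (.basic .not_lt_zero) a

theorem lt_succ (a b : M.Num) : a < b + 1 ↔ a < b ∨ a = b := by
  have := hM.satisfies _ (.basic .lt_succ) a b
  rw [Formula.sat_iff, Formula.sat_or] at this
  exact this

protected theorem zero_add (a : M.Num) : 0 + a = a :=
  sigma1_induction (fun a => 0 + a = a) (Number.add_zero 0) (fun a h => by rw [add_succ, h]) a

protected theorem add_assoc (a b c : M.Num) : a + b + c = a + (b + c) :=
  sigma1_induction (fun c => a + b + c = a + (b + c)) (by rw [Number.add_zero, Number.add_zero])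
    (fun c h => by rw [add_succ, h, add_succ, add_succ]) c

theorem one_add (a : M.Num) : 1 + a = a + 1 :=
  sigma1_induction (fun a => 1 + a = a + 1) (by rw [Number.add_zero, Number.zero_add])
    (fun a h => by rw [add_succ, h]) a

protected theorem add_comm (a b : M.Num) : a + b = b + a :=
  sigma1_induction (fun b => a + b = b + a) (by rw [Number.add_zero, Number.zero_add])
    (fun b h => by rw [add_succ, h, Number.add_assoc, ← one_add a, Number.add_assoc]) b

protected theorem add_right_cancel {a b c : M.Num} : a + c = b + c → a = b :=
  sigma1_induction (fun c => a + c = b + c → a = b)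
    (by rw [Number.add_zero, Number.add_zero]; exact id)
    (fun c h e => h (succ_inj (by rwa [add_succ, add_succ] at e))) c

protected theorem zero_mul (a : M.Num) : 0 * a = 0 :=
  sigma1_induction (fun a => 0 * a = 0) (Number.mul_zero 0)
    (fun a h => by rw [mul_succ, h, Number.add_zero]) a

theorem succ_mul (a b : M.Num) : (a + 1) * b = a * b + b :=
  sigma1_induction (fun b => (a + 1) * b = a * b + b)
    (by rw [Number.mul_zero, Number.mul_zero, Number.add_zero])
    (fun b h => by
      rw [mul_succ, h, mul_succ, add_succ, add_succ, Number.add_assoc _ b a, Number.add_comm b a,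
        ← Number.add_assoc]) b

protected theorem mul_comm (a b : M.Num) : a * b = b * a :=
  sigma1_induction (fun b => a * b = b * a) (by rw [Number.mul_zero, Number.zero_mul])
    (fun b h => by rw [mul_succ, succ_mul, h]) b

protected theorem mul_add (a b c : M.Num) : a * (b + c) = a * b + a * c :=
  sigma1_induction (fun c => a * (b + c) = a * b + a * c)
    (by rw [Number.mul_zero, Number.add_zero, Number.add_zero])
    (fun c h => by rw [add_succ, mul_succ, h, mul_succ, Number.add_assoc]) c

protected theorem mul_assoc (a b c : M.Num) : a * b * c = a * (b * c) :=
  sigma1_induction (fun c => a * b * c = a * (b * c)) (by simp only [Number.mul_zero])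
    (fun c h => by rw [mul_succ, h, mul_succ, Number.mul_add]) c

protected theorem mul_one (a : M.Num) : a * 1 = a := by
  rw [← Number.zero_add (1 : M.Num), mul_succ, Number.mul_zero, Number.zero_add]

instance : CommSemiring M.Num where
  add_assoc := Number.add_assoc
  zero_add := Number.zero_add
  add_zero := Number.add_zero
  add_comm := Number.add_comm
  nsmul := nsmulRec
  left_distrib := Number.mul_add
  right_distrib a b c := by
    rw [Number.mul_comm, Number.mul_add, Number.mul_comm c, Number.mul_comm c]
  zero_mul := Number.zero_mul
  mul_zero := Number.mul_zero
  mul_assoc := Number.mul_assoc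
  one_mul a := by rw [Number.mul_comm, Number.mul_one]
  mul_one := Number.mul_one
  mul_comm := Number.mul_comm

instance : IsCancelAdd M.Num where
  add_right_cancel _ _ _ h := Number.add_right_cancel h
  add_left_cancel a b c h := Number.add_right_cancel (c := a) (by simpa [Number.add_comm] using h)

theorem eq_zero_or_eq_succ (a : M.Num) : a = 0 ∨ ∃ b, a = b + 1 := by
  have : Sigma1 fun v : ℕ → M.Num => ∃ x, v 0 = 0 ∨ v 0 = x + 1 := .ex_delta0 _ inferInstance
  obtain ⟨x, h | h⟩ := sigma1_induction (fun a : M.Num => ∃ x, a = 0 ∨ a = x + 1)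
    ⟨0, .inl rfl⟩ (fun x _ => ⟨x, .inr rfl⟩) a
  exacts [.inl h, .inr ⟨x, h⟩]

/-- This ties the primitive relation `<` to addition; the order axioms below are derived from it. -/
theorem lt_iff_exists (a b : M.Num) : a < b ↔ ∃ c, b = a + c + 1 := by
  refine ⟨?_, fun ⟨c, hc⟩ => hc ▸ ?_⟩
  -- The quantifier is pulled in front of the implication to make the induction formula visibly
  -- $\Sigma^0_1$.
  · have : Sigma1 fun v : ℕ → M.Num => ∃ x, a < v 0 → v 0 = a + x + 1 := .ex_delta0 _ inferInstance
    have := sigma1_induction (fun b : M.Num => ∃ x, a < b → b = a + x + 1)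
      ⟨0, fun h => (not_lt_zero a h).elim⟩ (fun b ⟨x, h⟩ => ?_) b
    · exact fun h => this.imp fun x hx => hx h
    · by_cases hb : a < b
      · exact ⟨x + 1, fun _ => by rw [h hb]; ring⟩
      · refine ⟨0, fun h => ?_⟩
        rw [((lt_succ a b).1 h).resolve_left hb]; ring
  · refine sigma1_induction (fun c => a < a + c + 1) ?_ (fun c h => ?_) c
    · exact (lt_succ _ _).2 (.inr (by ring))
    · exact (lt_succ _ _).2 (.inl (by rwa [← add_assoc]))

protected theorem lt_trans {a b c : M.Num} (h : a < b) (h' : b < c) : a < c := by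
  obtain ⟨x, rfl⟩ := (lt_iff_exists _ _).1 h
  obtain ⟨y, rfl⟩ := (lt_iff_exists _ _).1 h'
  exact (lt_iff_exists _ _).2 ⟨x + y + 1, by ring⟩

protected theorem lt_irrefl (a : M.Num) : ¬ a < a := by
  rw [lt_iff_exists]
  rintro ⟨c, hc⟩
  refine succ_ne_zero c (add_left_cancel (a := a) ?_)
  rw [← add_assoc, ← hc, add_zero]

protected theorem zero_lt_succ (a : M.Num) : 0 < a + 1 := (lt_iff_exists _ _).2 ⟨a, by ring⟩

protected theorem lt_total (a b : M.Num) : a < b ∨ a = b ∨ b < a := by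
  refine sigma1_induction (fun b => a < b ∨ a = b ∨ b < a) ?_ (fun b h => ?_) b
  · obtain rfl | ⟨c, rfl⟩ := eq_zero_or_eq_succ a
    exacts [.inr (.inl rfl), .inr (.inr (Number.zero_lt_succ c))]
  · obtain h | h | h := h
    · exact .inl ((lt_succ _ _).2 (.inl h))
    · exact .inl ((lt_succ _ _).2 (.inr h))
    · obtain ⟨c, rfl⟩ := (lt_iff_exists _ _).1 h
      obtain rfl | ⟨d, rfl⟩ := eq_zero_or_eq_succ c
      · exact .inr (.inl (by ring))
      · exact .inr (.inr ((lt_iff_exists _ _).2 ⟨d, by ring⟩))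

noncomputable instance : LinearOrder M.Num where
  le a b := a < b ∨ a = b
  le_refl a := .inr rfl
  le_trans a b c := by
    rintro (h | rfl) (h' | rfl)
    exacts [.inl (Number.lt_trans h h'), .inl h, .inl h', .inr rfl]
  lt_iff_le_not_ge a b := by
    refine ⟨fun h => ⟨.inl h, ?_⟩, fun ⟨h, h'⟩ => h.resolve_right fun e => h' (.inr e.symm)⟩
    rintro (h' | rfl)
    exacts [Number.lt_irrefl _ (Number.lt_trans h h'), Number.lt_irrefl _ h]
  le_antisymm a b := by
    rintro (h | rfl) (h' | h')
    exacts [(Number.lt_irrefl _ (Number.lt_trans h h')).elim, h'.symm, rfl, rfl]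
  le_total a b := by
    obtain h | h | h := Number.lt_total a b
    exacts [.inl (.inl h), .inl (.inr h), .inr (.inl h)]
  toDecidableLE := Classical.decRel _

theorem lt_add_one_iff {a b : M.Num} : a < b + 1 ↔ a ≤ b := lt_succ a b

theorem add_one_le_iff {a b : M.Num} : a + 1 ≤ b ↔ a < b := by
  rw [← not_lt, lt_add_one_iff, not_le]

protected theorem le_iff_exists (a b : M.Num) : a ≤ b ↔ ∃ c, b = a + c := by
  constructor
  · rintro (h | rfl)
    · obtain ⟨c, rfl⟩ := (lt_iff_exists _ _).1 h
      exact ⟨c + 1, by ring⟩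
    · exact ⟨0, by ring⟩
  · rintro ⟨c, rfl⟩
    obtain rfl | ⟨d, rfl⟩ := eq_zero_or_eq_succ c
    · exact .inr (by ring)
    · exact .inl ((lt_iff_exists _ _).2 ⟨d, by ring⟩)

instance : IsOrderedCancelAddMonoid M.Num where
  add_le_add_left a b h c := by
    obtain ⟨d, rfl⟩ := (Number.le_iff_exists _ _).1 h
    exact (Number.le_iff_exists _ _).2 ⟨d, by ring⟩
  le_of_add_le_add_left a b c h := by
    obtain ⟨d, hd⟩ := (Number.le_iff_exists _ _).1 h
    exact (Number.le_iff_exists _ _).2 ⟨d, add_left_cancel (a := a) (by rw [hd]; ring)⟩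

instance : CanonicallyOrderedAdd M.Num where
  exists_add_of_le h := (Number.le_iff_exists _ _).1 h
  le_add_self a b := (Number.le_iff_exists _ _).2 ⟨b, by ring⟩
  le_self_add a b := (Number.le_iff_exists _ _).2 ⟨b, rfl⟩

instance : Nontrivial M.Num := ⟨1, 0, fun h => succ_ne_zero (0 : M.Num) (by rwa [zero_add])⟩

protected theorem mul_lt_mul_left {a b c : M.Num} (ha : 0 < a) (h : b < c) : a * b < a * c := by
  obtain ⟨x, rfl⟩ := (lt_iff_exists _ _).1 ha
  obtain ⟨y, rfl⟩ := (lt_iff_exists _ _).1 h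
  exact (lt_iff_exists _ _).2 ⟨x * y + x + y, by ring⟩

instance : IsStrictOrderedRing M.Num where
  mul_lt_mul_of_pos_left a ha b c h := Number.mul_lt_mul_left ha h
  mul_lt_mul_of_pos_right a ha b c h := by
    simpa only [mul_comm _ a] using Number.mul_lt_mul_left ha h
  zero_le_one := zero_le
  exists_pair_ne := ⟨1, 0, fun h => succ_ne_zero (0 : M.Num) (by rwa [zero_add])⟩

end Number
end Arithmetic

/-! ### Closure properties of `Σ⁰₁` relations -/

section Sigma1

variable {M : Model.{u}} {f : (ℕ → M.Num) → M.Num} {P Q : (ℕ → M.Num) → Prop}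
  {R : M.Num → (ℕ → M.Num) → Prop}

theorem Delta0.comp_scons (hR : Delta0 fun v => R (v 0) fun i => v (i + 1)) (hf : PolyFn f)
    (s : (ℕ → M.Num) → ℕ → M.Num) (hs : ∀ i, PolyFn fun v => s v i) :
    Delta0 fun v => R (f v) (s v) :=
  hR.comp (fun v => scons (f v) (s v)) fun i => by
    cases i <;> simp_all [scons]

theorem Sigma1.comp (hP : Sigma1 P) (s : (ℕ → M.Num) → ℕ → M.Num)
    (hs : ∀ i, PolyFn fun v => s v i) : Sigma1 fun v => P (s v) := by
  obtain ⟨S, hS, h⟩ := hP.out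
  refine ⟨fun x v => S x (s v), hS.comp_scons (.var 0) _ fun i => ?_, fun v => h _⟩
  exact (hs i).comp (fun v i => v (i + 1)) fun i => .var (i + 1)

theorem Sigma1.comp₂ {R : M.Num → M.Num → Prop} {g : (ℕ → M.Num) → M.Num}
    (h : Sigma1 fun v => R (v 0) (v 1)) (hf : PolyFn f) (hg : PolyFn g) :
    Sigma1 fun v => R (f v) (g v) :=
  h.comp (fun v => scons (f v) fun _ => g v) fun i => by cases i <;> assumption

variable [M.IsRCA0]

instance {g : (ℕ → M.Num) → M.Num} [PolyFn f] [PolyFn g] : Delta0 fun v => f v ≤ g v :=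
  .congr (fun v => f v < g v ∨ f v = g v) fun _ => le_iff_lt_or_eq

instance [hP : Sigma1 P] [hQ : Sigma1 Q] : Sigma1 fun v => P v ∧ Q v := by
  obtain ⟨S, hS, h⟩ := hP.out
  obtain ⟨S', hS', h'⟩ := hQ.out
  -- Two unbounded witnesses merge into one: a common strict upper bound `z`.
  refine ⟨fun z v => (∃ x, x < z ∧ S x v) ∧ ∃ x, x < z ∧ S' x v, ?_, fun v => ?_⟩
  · have := hS.comp_scons (.var 0) (fun v i => v (i + 1 + 1)) fun i => .var (i + 1 + 1)
    have := hS'.comp_scons (.var 0) (fun v i => v (i + 1 + 1)) fun i => .var (i + 1 + 1)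
    infer_instance
  · rw [h, h']
    constructor
    · rintro ⟨⟨x, hx⟩, y, hy⟩
      exact ⟨max x y + 1, ⟨x, by simp [Number.lt_add_one_iff], hx⟩,
        ⟨y, by simp [Number.lt_add_one_iff], hy⟩⟩
    · rintro ⟨z, ⟨x, -, hx⟩, y, -, hy⟩
      exact ⟨⟨x, hx⟩, y, hy⟩

instance [hP : Sigma1 P] [hQ : Sigma1 Q] : Sigma1 fun v => P v ∨ Q v := by
  obtain ⟨S, hS, h⟩ := hP.out
  obtain ⟨S', hS', h'⟩ := hQ.out
  exact ⟨fun z v => S z v ∨ S' z v, inferInstance, fun v => by rw [h, h', exists_or]⟩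

instance [Delta0 P] [Sigma1 Q] : Sigma1 fun v => P v → Q v :=
  .congr (fun v => ¬ P v ∨ Q v) fun _ => imp_iff_not_or

instance [hR : Sigma1 fun v => R (v 0) fun i => v (i + 1)] : Sigma1 fun v => ∃ x, R x v := by
  obtain ⟨S, hS, h⟩ := hR.out
  refine ⟨fun z v => ∃ x, x < z ∧ ∃ y, y < z ∧ S y (scons x v), ?_, fun v => ?_⟩
  · have := hS.comp_scons (.var 0) (fun v => scons (v 1) fun i => v (i + 1 + 1 + 1)) fun i => by
      cases i <;> exact .var _
    infer_instance
  · have h (x : M.Num) : R x v ↔ ∃ y, S y (scons x v) := h (scons x v)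
    rw [exists_congr h]
    constructor
    · rintro ⟨x, y, hy⟩
      exact ⟨max x y + 1, x, by simp [Number.lt_add_one_iff],
        y, by simp [Number.lt_add_one_iff], hy⟩
    · rintro ⟨z, x, -, y, -, hy⟩
      exact ⟨x, y, hy⟩

/-- Induction on the part of the range already covered; the bound `b` is the only unbounded
quantifier. It makes $\Sigma^0_1$ relations closed under bounded universal quantification. -/
theorem sigma1_collection (S : M.Num → M.Num → Prop) (hS : Delta0 fun v => S (v 0) (v 1))
    (a : M.Num) (h : ∀ x, x < a → ∃ y, S x y) :
    ∃ b, ∀ x, x < a → ∃ y, y < b ∧ S x y := by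
  have : Delta0 fun v : ℕ → M.Num => S (v 1) (v 0) := hS.comp₂ (.var 1) (.var 0)
  refine sigma1_induction (fun j => j ≤ a → ∃ b, ∀ x, x < j → ∃ y, y < b ∧ S x y)
    (fun _ => ⟨0, fun x hx => (Number.not_lt_zero x hx).elim⟩) (fun j ih hj => ?_) a le_rfl
  rw [Number.add_one_le_iff] at hj
  obtain ⟨b, hb⟩ := ih hj.le
  obtain ⟨y, hy⟩ := h j hj
  refine ⟨max b (y + 1), fun x hx => ?_⟩
  obtain hx | rfl := (Number.lt_add_one_iff.1 hx).lt_or_eq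
  · obtain ⟨z, hz, hz'⟩ := hb x hx
    exact ⟨z, lt_max_of_lt_left hz, hz'⟩
  · exact ⟨y, lt_max_of_lt_right (Number.lt_add_one_iff.2 le_rfl), hy⟩

instance [hf : PolyFn f] [hR : Sigma1 fun v => R (v 0) fun i => v (i + 1)] :
    Sigma1 fun v => ∀ x, x < f v → R x v := by
  obtain ⟨S, hS, h⟩ := hR.out
  refine ⟨fun b v => ∀ x, x < f v → ∃ y, y < b ∧ S y (scons x v), ?_, fun v => ?_⟩
  · have := hS.comp_scons (.var 0) (fun v => scons (v 1) fun i => v (i + 1 + 1 + 1)) fun i => by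
      cases i <;> exact .var _
    have := hf.comp (fun v i => v (i + 1)) fun i => .var (i + 1)
    infer_instance
  · have h (x : M.Num) : R x v ↔ ∃ y, S y (scons x v) := h (scons x v)
    rw [forall_congr' fun x => imp_congr_right fun _ => h x]
    refine ⟨sigma1_collection (fun x y => S y (scons x v)) ?_ _, ?_⟩
    · exact hS.comp_scons (.var 1) (fun w => scons (w 0) v) fun i => by
        cases i; exacts [.var 0, .const _]
    · rintro ⟨b, hb⟩ x hx
      obtain ⟨y, -, hy⟩ := hb x hx
      exact ⟨y, hy⟩

theorem exists_least (P : M.Num → Prop) [Delta0 fun v => P (v 0)] {a : M.Num} (ha : P a) :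
    ∃ b, b ≤ a ∧ P b ∧ ∀ c, c < b → ¬ P c := by
  by_contra! H
  refine sigma1_induction (fun x => x ≤ a + 1 → ∀ y, y < x → ¬ P y)
    (fun _ y hy => (Number.not_lt_zero y hy).elim) (fun x ih hx y hy hP => ?_)
    (a + 1) le_rfl a (Number.lt_add_one_iff.2 le_rfl) ha
  have hx' : x ≤ a := Number.lt_add_one_iff.1 (Number.add_one_le_iff.1 hx)
  obtain ⟨c, hc, hPc⟩ := H y ((Number.lt_add_one_iff.1 hy).trans hx') hP
  exact ih (hx'.trans (Number.lt_add_one_iff.2 le_rfl).le) c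
    (hc.trans_le (Number.lt_add_one_iff.1 hy)) hPc

end Sigma1

/-! ### Division and the Chinese remainder theorem -/

namespace Number

variable {M : Model.{u}} [M.IsRCA0]

theorem exists_div (a : M.Num) {d : M.Num} (hd : 0 < d) : ∃ q r, a = q * d + r ∧ r < d := by
  refine sigma1_induction (fun a => ∃ q r, a = q * d + r ∧ r < d) ⟨0, 0, by ring, hd⟩ ?_ a
  rintro _ ⟨q, r, rfl, hr⟩
  obtain h | h := (add_one_le_iff.2 hr).lt_or_eq
  · exact ⟨q, r + 1, by ring, h⟩
  · exact ⟨q + 1, 0, by linear_combination h, hd⟩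

theorem rem_unique {q q' d r r' : M.Num} (h : q * d + r = q' * d + r') (hr : r < d) (hr' : r' < d) :
    r = r' := by
  wlog hq : q ≤ q' generalizing q q' r r'
  · exact (this h.symm hr' hr (not_le.1 hq).le).symm
  obtain ⟨c, rfl⟩ := exists_add_of_le hq
  obtain rfl | ⟨e, rfl⟩ := eq_zero_or_eq_succ c
  · linear_combination h
  · have h0 : r = e * d + d + r' := by linear_combination h
    have h1 : d ≤ r := h0 ▸ by rw [add_assoc, add_left_comm]; exact le_self_add
    exact (hr.not_ge h1).elim

/-- `x` is invertible modulo `y`. -/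
def InvMod (x y : M.Num) : Prop := ∃ u w, u * x = w * y + 1

instance {f g : (ℕ → M.Num) → M.Num} [PolyFn f] [PolyFn g] : Sigma1 fun v => InvMod (f v) (g v) :=
  Sigma1.comp₂ (R := InvMod) (by unfold InvMod; infer_instance) ‹_› ‹_›

theorem InvMod.mul {x x' y : M.Num} : InvMod x y → InvMod x' y → InvMod (x * x') y := by
  rintro ⟨u, w, h⟩ ⟨u', w', h'⟩
  exact ⟨u * u', w * w' * y + w + w', by linear_combination u' * x' * h + (w * y + 1) * h'⟩

theorem invMod_one (y : M.Num) : InvMod 1 y := ⟨1, 0, by ring⟩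

/-- The two moduli differ by `m * b`, each is prime to `b`, and `m` divides `b`; hence they are
coprime, as an explicit Bézout identity shows. -/
theorem invMod_modulus {i m b c : M.Num} (hb : 0 < b) (h : b = m * c) :
    InvMod ((i + 1) * b + 1) ((i + m + 1) * b + 1) := by
  obtain ⟨e, rfl⟩ : ∃ e, b = e + 1 := (eq_zero_or_eq_succ b).resolve_left hb.ne'
  -- Modulo `(i + m + 1) * b + 1` the inverse is `1 - (i + 1) * (i + m + 1) * c`. As `(i + m + 1) *
  -- e + 1` is congruent to `-(i + m + 1)`, subtraction is avoided.
  refine ⟨1 + (i + 1) * (i + m + 1) * c * e + (i + 1) * c,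
    (i + 1) * (i + 1) * c * e + (i + 1) * c, ?_⟩
  linear_combination (i + 1) * h

variable {b D l : M.Num}

/-- In effect `b = (K + 1) * l!`. Divisibility makes the moduli `(i + 1) * b + 1` coprime, and `K ≤
b` leaves room for entries below `K`. -/
theorem exists_common_multiple (K l : M.Num) :
    ∃ b, K ≤ b ∧ 0 < b ∧ ∀ m, m < l → ∃ c, b = (m + 1) * c := by
  refine sigma1_induction (fun l => ∃ b, K ≤ b ∧ 0 < b ∧ ∀ m, m < l → ∃ c, b = (m + 1) * c)
    ⟨K + 1, le_self_add, Number.zero_lt_succ K, fun m hm => (not_lt_zero m hm).elim⟩ ?_ l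
  rintro l ⟨b, hK, hb, h⟩
  refine ⟨(l + 1) * b, hK.trans ?_, mul_pos (Number.zero_lt_succ l) hb, fun m hm => ?_⟩
  · rw [add_mul, one_mul]; exact le_add_self
  obtain hm | rfl := (lt_add_one_iff.1 hm).lt_or_eq
  · obtain ⟨c, hc⟩ := h m hm
    exact ⟨(l + 1) * c, by rw [hc]; ring⟩
  · exact ⟨b, rfl⟩

/-- In effect `D` is the product of the moduli; reducing a solution of the congruences modulo `D`
will bound it. -/
theorem exists_moduli_multiple (b l : M.Num) :
    ∃ D, 0 < D ∧ ∀ i, i < l → ∃ e, D = e * ((i + 1) * b + 1) := by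
  refine sigma1_induction (fun l => ∃ D, 0 < D ∧ ∀ i, i < l → ∃ e, D = e * ((i + 1) * b + 1))
    ⟨1, zero_lt_one, fun m hm => (not_lt_zero m hm).elim⟩ ?_ l
  rintro l ⟨D, hD, h⟩
  refine ⟨D * ((l + 1) * b + 1), mul_pos hD (Number.zero_lt_succ _), fun m hm => ?_⟩
  obtain hm | rfl := (lt_add_one_iff.1 hm).lt_or_eq
  · obtain ⟨c, hc⟩ := h m hm
    exact ⟨c * ((l + 1) * b + 1), by rw [hc]; ring⟩
  · exact ⟨D, rfl⟩

/-- The congruences are solved one at a time. The product `D` of the moduli already treated is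
carried along: it is invertible modulo the others, so adding multiples of it repairs the next
congruence and disturbs no earlier one. The relation `U` need not be single-valued; a value is
chosen at each step. -/
theorem exists_crt (hb : 0 < b) (hbl : ∀ m, m < l → ∃ c, b = (m + 1) * c)
    (U : M.Num → M.Num → Prop) [hU' : Sigma1 fun v => U (v 0) (v 1)] {n : M.Num} (hn : n ≤ l)
    (hU : ∀ i, i < n → ∃ u, U i u) :
    ∃ a, ∀ i, i < n → ∃ u, U i u ∧ ∃ q, a = q * ((i + 1) * b + 1) + u := by
  have : Sigma1 fun v : ℕ → M.Num => U (v 1) (v 0) := hU'.comp₂ (.var 1) (.var 0)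
  suffices ∃ a D, (∀ i, i < l → n ≤ i → InvMod D ((i + 1) * b + 1)) ∧
      (∀ i, i < n → ∃ e, D = e * ((i + 1) * b + 1)) ∧
      ∀ i, i < n → ∃ u, U i u ∧ ∃ q, a = q * ((i + 1) * b + 1) + u by
    obtain ⟨a, -, -, -, h⟩ := this
    exact ⟨a, h⟩
  refine sigma1_induction (fun j => j ≤ n → ∃ a D,
      (∀ i, i < l → j ≤ i → InvMod D ((i + 1) * b + 1)) ∧
      (∀ i, i < j → ∃ e, D = e * ((i + 1) * b + 1)) ∧
      ∀ i, i < j → ∃ u, U i u ∧ ∃ q, a = q * ((i + 1) * b + 1) + u) (fun _ => ?_)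
    (fun j ih hj => ?_) n le_rfl
  · exact ⟨0, 1, fun i _ _ => invMod_one _, fun i hi => (not_lt_zero i hi).elim,
      fun i hi => (not_lt_zero i hi).elim⟩
  · rw [add_one_le_iff] at hj
    obtain ⟨a, D, hinv, hdvd, ha⟩ := ih hj.le
    obtain ⟨u, hu⟩ := hU j hj
    obtain ⟨p, w, hpw⟩ := hinv j (hj.trans_le hn) le_rfl
    -- Modulo `(j + 1) * b + 1`, `p` inverts `D` and `(j + 1) * b` is `-1`, so the added term is `u
    -- - a`.
    refine ⟨a + D * (p * (u + a * ((j + 1) * b))), D * ((j + 1) * b + 1), fun i hi hji => ?_,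
      fun i hi => ?_, fun i hi => ?_⟩
    · rw [add_one_le_iff] at hji
      obtain ⟨m, rfl⟩ := (lt_iff_exists _ _).1 hji
      obtain ⟨c, hc⟩ := hbl m ((lt_add_one_iff.2 le_add_self).trans hi)
      refine (hinv _ hi hji.le).mul ?_
      have := invMod_modulus (i := j) (m := m + 1) hb hc
      rwa [← add_assoc] at this
    · obtain hi | rfl := (lt_add_one_iff.1 hi).lt_or_eq
      · obtain ⟨e, he⟩ := hdvd i hi
        exact ⟨e * ((j + 1) * b + 1), by rw [he]; ring⟩
      · exact ⟨D, rfl⟩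
    · obtain hi | rfl := (lt_add_one_iff.1 hi).lt_or_eq
      · obtain ⟨e, he⟩ := hdvd i hi
        obtain ⟨u', hu', q, hq⟩ := ha i hi
        exact ⟨u', hu', q + e * (p * (u + a * ((j + 1) * b))), by rw [he]; linear_combination hq⟩
      · exact ⟨u, hu, a + w * (u + a * ((i + 1) * b)),
          by linear_combination (u + a * ((i + 1) * b)) * hpw⟩

end Number

/-! ### Codes of finite strings -/

namespace Number

section Pairing

variable {M : Model.{u}}

/-- The pairing function `⟨s, t⟩ = (s + t)² + s`. -/
def pair (s t : M.Num) : M.Num := (s + t) * (s + t) + s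

instance {f g : (ℕ → M.Num) → M.Num} [PolyFn f] [PolyFn g] : PolyFn fun v => pair (f v) (g v) :=
  inferInstanceAs (PolyFn fun v => (f v + g v) * (f v + g v) + f v)

variable [M.IsRCA0]

theorem le_mul_self (a : M.Num) : a ≤ a * a := by
  obtain rfl | ⟨b, rfl⟩ := eq_zero_or_eq_succ a
  · exact zero_le
  · exact le_mul_of_one_le_left' (by exact le_add_self)

theorem left_le_pair (s t : M.Num) : s ≤ pair s t := le_add_self

theorem right_le_pair (s t : M.Num) : t ≤ pair s t :=
  le_add_self.trans ((le_mul_self (s + t)).trans le_self_add)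

theorem pair_le_pair {s s' t t' : M.Num} (hs : s ≤ s') (ht : t ≤ t') : pair s t ≤ pair s' t' := by
  unfold pair
  gcongr

theorem pair_lt_pair {s s' t t' : M.Num} (h : s + t < s' + t') : pair s t < pair s' t' := by
  have h1 : (s + t + 1) * (s + t + 1) ≤ (s' + t') * (s' + t') :=
    mul_le_mul (add_one_le_iff.2 h) (add_one_le_iff.2 h) zero_le zero_le
  refine lt_of_lt_of_le (b := (s + t + 1) * (s + t + 1)) ?_ (h1.trans le_self_add)
  exact (lt_iff_exists _ _).2 ⟨s + t + t, by unfold pair; ring⟩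

theorem pair_inj {s s' t t' : M.Num} : pair s t = pair s' t' ↔ s = s' ∧ t = t' := by
  refine ⟨fun h => ?_, fun ⟨h, h'⟩ => h ▸ h' ▸ rfl⟩
  have hsum : s + t = s' + t' := by
    obtain h' | h' | h' := lt_trichotomy (s + t) (s' + t')
    exacts [((pair_lt_pair h').ne h).elim, h', ((pair_lt_pair h').ne' h).elim]
  have hs : s = s' := by
    unfold pair at h
    rw [hsum] at h
    exact add_left_cancel h
  subst hs
  exact ⟨rfl, add_left_cancel hsum⟩

end Pairing

end Number

section Strings

open Number

variable {M : Model.{u}}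

/-- `s` represents a string of length `l`. -/
def StrLen (s l : M.Num) : Prop := ∃ a b, s = pair l (pair a b)

/-- `s` represents a string with entry `v` at position `i`. -/
def Entry (s i v : M.Num) : Prop :=
  ∃ l a b q, s = pair l (pair a b) ∧ i < l ∧ a = q * ((i + 1) * b + 1) + v ∧ v < (i + 1) * b + 1

/-- `s` and `t` represent the same string. -/
def SameStr (s t : M.Num) : Prop :=
  (∃ l, StrLen s l ∧ StrLen t l) ∧ ∀ i v, Entry s i v ↔ Entry t i v

/-- `s` is the code of a string. -/
def IsStr (s : M.Num) : Prop := (∃ l, StrLen s l) ∧ ∀ t, t < s → ¬ SameStr t s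

/-- `s` is the code of a string with entries less than `K`. -/
def IsStrOver (K s : M.Num) : Prop := IsStr s ∧ ∀ i v, Entry s i v → v < K

/-- The string `t` is a prefix of the string `s`. -/
def IsPre (t s : M.Num) : Prop := ∀ i v, Entry t i v → Entry s i v

variable [M.IsRCA0] {s t l n i v w : M.Num}

theorem StrLen.le (h : StrLen s l) : l ≤ s := by
  obtain ⟨a, b, rfl⟩ := h
  exact left_le_pair _ _

theorem StrLen.unique (h : StrLen s l) (h' : StrLen s n) : l = n := by
  obtain ⟨a, b, rfl⟩ := h
  obtain ⟨a', b', h⟩ := h'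
  exact (pair_inj.1 h).1

theorem Entry.lt (h : Entry s i v) (hl : StrLen s l) : i < l := by
  obtain ⟨n, a, b, q, rfl, hi, -⟩ := h
  rwa [hl.unique ⟨a, b, rfl⟩]

theorem Entry.index_le (h : Entry s i v) : i ≤ s := by
  obtain ⟨n, a, b, q, rfl, hi, -⟩ := h
  exact hi.le.trans (left_le_pair _ _)

theorem Entry.value_le (h : Entry s i v) : v ≤ s := by
  obtain ⟨n, a, b, q, rfl, hi, rfl, -⟩ := h
  exact le_add_self.trans ((left_le_pair _ _).trans (right_le_pair _ _))

theorem Entry.unique (h : Entry s i v) (h' : Entry s i w) : v = w := by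
  obtain ⟨n, a, b, q, rfl, -, rfl, hv⟩ := h
  obtain ⟨n', a', b', q', h, -, h', hw⟩ := h'
  obtain ⟨ha, rfl⟩ := pair_inj.1 (pair_inj.1 h).2
  exact rem_unique (ha.trans h') hv hw

theorem StrLen.exists_entry (h : StrLen s l) (hi : i < l) : ∃ v, Entry s i v := by
  obtain ⟨a, b, rfl⟩ := h
  obtain ⟨q, r, ha, hr⟩ := exists_div a (Number.zero_lt_succ ((i + 1) * b))
  exact ⟨r, l, a, b, q, rfl, hi, ha, hr⟩

section Definability

variable {f g h : (ℕ → M.Num) → M.Num}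

instance [hf : PolyFn f] [hg : PolyFn g] : Delta0 fun v => StrLen (f v) (g v) := by
  refine Delta0.comp₂ (.congr (fun v => ∃ a, a < v 0 + 1 ∧ ∃ b, b < v 0 + 1 ∧
    v 0 = pair (v 1) (pair a b)) fun v => ⟨?_, ?_⟩) hf hg
  · rintro ⟨a, b, h⟩
    exact ⟨a, lt_add_one_iff.2 (h ▸ (left_le_pair _ _).trans (right_le_pair _ _)),
      b, lt_add_one_iff.2 (h ▸ (right_le_pair _ _).trans (right_le_pair _ _)), h⟩
  · rintro ⟨a, -, b, -, h⟩
    exact ⟨a, b, h⟩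

instance [hf : PolyFn f] [hg : PolyFn g] [hh : PolyFn h] :
    Delta0 fun v => Entry (f v) (g v) (h v) := by
  refine Delta0.comp₃ (.congr (fun v => ∃ l, l < v 0 + 1 ∧ ∃ a, a < v 0 + 1 ∧ ∃ b, b < v 0 + 1 ∧
    ∃ q, q < v 0 + 1 ∧ v 0 = pair l (pair a b) ∧ v 1 < l ∧ a = q * ((v 1 + 1) * b + 1) + v 2 ∧
    v 2 < (v 1 + 1) * b + 1) fun v => ⟨?_, ?_⟩) hf hg hh
  · rintro ⟨l, a, b, q, h, h1, h2, h3⟩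
    have ha : a ≤ v 0 := h ▸ (left_le_pair _ _).trans (right_le_pair _ _)
    refine ⟨l, lt_add_one_iff.2 (h ▸ left_le_pair _ _), a, lt_add_one_iff.2 ha,
      b, lt_add_one_iff.2 (h ▸ (right_le_pair _ _).trans (right_le_pair _ _)),
      q, lt_add_one_iff.2 (le_trans ?_ ha), h, h1, h2, h3⟩
    rw [h2]
    exact (le_mul_of_one_le_right' (by exact le_add_self)).trans le_self_add
  · rintro ⟨l, -, a, -, b, -, q, -, h⟩
    exact ⟨l, a, b, q, h⟩

instance [hf : PolyFn f] [hg : PolyFn g] : Delta0 fun v => SameStr (f v) (g v) := by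
  refine Delta0.comp₂ (.congr (fun v => (∃ l, l < v 0 + 1 ∧ StrLen (v 0) l ∧ StrLen (v 1) l) ∧
    ∀ i, i < v 0 + v 1 + 1 → ∀ w, w < v 0 + v 1 + 1 → (Entry (v 0) i w ↔ Entry (v 1) i w))
    fun v => ⟨?_, ?_⟩) hf hg
  · rintro ⟨⟨l, h, h'⟩, H⟩
    exact ⟨⟨l, lt_add_one_iff.2 h.le, h, h'⟩, fun i _ w _ => H i w⟩
  · rintro ⟨⟨l, -, h⟩, H⟩
    refine ⟨⟨l, h⟩, fun i w => ⟨fun h => (H i ?_ w ?_).1 h, fun h => (H i ?_ w ?_).2 h⟩⟩ <;>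
      rw [lt_add_one_iff]
    exacts [h.index_le.trans le_self_add, h.value_le.trans le_self_add,
      h.index_le.trans le_add_self, h.value_le.trans le_add_self]

instance [hf : PolyFn f] [hg : PolyFn g] : Delta0 fun v => IsStrOver (f v) (g v) := by
  refine Delta0.comp₂ (.congr (fun v => ((∃ l, l < v 1 + 1 ∧ StrLen (v 1) l) ∧
    ∀ t, t < v 1 → ¬ SameStr t (v 1)) ∧ ∀ i, i < v 1 + 1 → ∀ w, w < v 1 + 1 →
    Entry (v 1) i w → w < v 0) fun v => ⟨?_, ?_⟩) hf hg
  · rintro ⟨⟨⟨l, h⟩, h'⟩, H⟩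
    exact ⟨⟨⟨l, lt_add_one_iff.2 h.le, h⟩, h'⟩, fun i _ w _ => H i w⟩
  · rintro ⟨⟨⟨l, -, h⟩, h'⟩, H⟩
    exact ⟨⟨⟨l, h⟩, h'⟩, fun i w h => H i (lt_add_one_iff.2 h.index_le) w
      (lt_add_one_iff.2 h.value_le) h⟩

end Definability

/-- Every representative of a string is at least the code of that string. -/
theorem StrLen.exists_isStr (h : StrLen s l) :
    ∃ t, t ≤ s ∧ IsStr t ∧ StrLen t l ∧ ∀ i v, Entry t i v ↔ Entry s i v := by
  obtain ⟨t, hts, ⟨⟨n, ht, hs⟩, hent⟩, hmin⟩ := exists_least (fun t => SameStr t s)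
    (a := s) ⟨⟨l, h, h⟩, fun _ _ => Iff.rfl⟩
  obtain rfl := hs.unique h
  refine ⟨t, hts, ⟨⟨n, ht⟩, fun r hr hrt => hmin r hr ?_⟩, ht, hent⟩
  obtain ⟨⟨m, hr, ht'⟩, h'⟩ := hrt
  obtain rfl := ht.unique ht'
  exact ⟨⟨n, hr, hs⟩, fun i v => (h' i v).trans (hent i v)⟩

/-- `⟨l, ⟨D, b⟩⟩` bounds the codes of the strings of length at most `l` with entries less than
`K`. -/
def StrBound (K l b D : M.Num) : Prop :=
  K ≤ b ∧ 0 < b ∧ (∀ m, m < l → ∃ c, b = (m + 1) * c) ∧ 0 < D ∧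
    ∀ i, i < l → ∃ e, D = e * ((i + 1) * b + 1)

theorem exists_strBound (K l : M.Num) : ∃ b D, StrBound K l b D := by
  obtain ⟨b, hK, hb, h⟩ := exists_common_multiple K l
  obtain ⟨D, hD, h'⟩ := exists_moduli_multiple b l
  exact ⟨b, D, hK, hb, h, hD, h'⟩

variable {K b D : M.Num}

/-- The solution of the congruences is replaced by its remainder modulo `D`, which has the same
remainders modulo the moduli in use. This gives a representative below the bound, and the code is no
larger. -/
theorem StrBound.exists_isStr (h : StrBound K l b D) (U : M.Num → M.Num → Prop)
    [Sigma1 fun v => U (v 0) (v 1)] (hn : n ≤ l) (hU : ∀ i, i < n → ∃ u, U i u ∧ u < K) :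
    ∃ s, s ≤ pair l (pair D b) ∧ IsStr s ∧ StrLen s n ∧
      ∀ i, i < n → ∃ u, (U i u ∧ u < K) ∧ Entry s i u := by
  obtain ⟨hK, hb, hbl, hD, hDl⟩ := h
  obtain ⟨a, ha⟩ := exists_crt hb hbl (fun i u => U i u ∧ u < K) hn hU
  obtain ⟨p, r, rfl, hr⟩ := exists_div a hD
  obtain ⟨s, hs, hstr, hlen, hent⟩ := StrLen.exists_isStr (s := pair n (pair r b)) ⟨r, b, rfl⟩
  refine ⟨s, hs.trans (pair_le_pair hn (pair_le_pair hr.le le_rfl)), hstr, hlen, fun i hi => ?_⟩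
  obtain ⟨u, hu, q, hq⟩ := ha i hi
  refine ⟨u, hu, (hent i u).2 ⟨n, r, b, ?_⟩⟩
  obtain ⟨e, rfl⟩ := hDl i (hi.trans_le hn)
  obtain ⟨q', r', hr', hlt⟩ := exists_div r (Number.zero_lt_succ ((i + 1) * b))
  -- An entry below `K ≤ b` is smaller than its modulus, hence it is the remainder itself.
  have hu' : u < (i + 1) * b + 1 := by
    refine hu.2.trans_le (hK.trans (le_trans ?_ le_self_add))
    exact le_mul_of_one_le_left' (by exact le_add_self)
  obtain rfl : u = r' := rem_unique (q := q) (q' := p * e + q') (by rw [← hq, hr']; ring) hu' hlt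
  exact ⟨q', rfl, hi, hr', hlt⟩

theorem exists_isStr (K n : M.Num) (U : M.Num → M.Num → Prop) [Sigma1 fun v => U (v 0) (v 1)]
    (hU : ∀ i, i < n → ∃ u, U i u ∧ u < K) :
    ∃ s, IsStr s ∧ StrLen s n ∧ ∀ i, i < n → ∃ u, (U i u ∧ u < K) ∧ Entry s i u := by
  obtain ⟨b, D, h⟩ := exists_strBound K n
  obtain ⟨s, -, hs⟩ := h.exists_isStr U le_rfl hU
  exact ⟨s, hs⟩

/-- The same string has a representative below the bound, and its code is the least representative.
-/
theorem StrBound.le (h : StrBound K l b D) (hs : IsStrOver K s) (hlen : StrLen s n) (hn : n ≤ l) :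
    s ≤ pair l (pair D b) := by
  obtain ⟨t, ht, -, htlen, hent⟩ := h.exists_isStr (n := n) (fun i u => Entry s i u) hn
      fun i hi => by
    obtain ⟨v, hv⟩ := hlen.exists_entry hi
    exact ⟨v, hv, hs.2 i v hv⟩
  refine le_trans (not_lt.1 fun hlt => hs.1.2 t hlt ⟨⟨n, htlen, hlen⟩, fun i v => ?_⟩) ht
  constructor
  · intro h
    obtain ⟨u, hu, hu'⟩ := hent i (h.lt htlen)
    exact h.unique hu' ▸ hu.1
  · intro h
    obtain ⟨u, hu, hu'⟩ := hent i (h.lt hlen)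
    exact h.unique hu.1 ▸ hu'

end Strings

/-! ### Trees -/

section Trees

open Number

variable {M : Model.{u}}

/-- `T` is a tree of strings with entries less than `K`. -/
def IsTree (K : M.Num) (T : M.sets) : Prop :=
  ∀ s, s ∈ (T : Set M.Num) → IsStrOver K s ∧ ∀ t, IsStr t ∧ IsPre t s → t ∈ (T : Set M.Num)

/-- The set `X` is infinite. -/
def Infinite (X : M.sets) : Prop := ∀ x, ∃ y, x < y ∧ y ∈ (X : Set M.Num)

/-- All entries of the string `s` at positions in `H` are equal to `c`. -/
def HomWith (H : M.sets) (c s : M.Num) : Prop :=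
  ∀ i, i ∈ (H : Set M.Num) → ∀ v, Entry s i v → v = c

variable [M.IsRCA0] {K J : M.Num} {T : M.sets}

/-- Strings of length at most `n` have bounded codes, so unboundedly large codes force unboundedly
long strings. `P` need not be definable. -/
theorem IsTree.exists_long (hT : IsTree K T) (P : M.Num → Prop)
    (hP : ∀ x, ∃ s, x < s ∧ s ∈ (T : Set M.Num) ∧ P s) (n : M.Num) :
    ∃ s l, s ∈ (T : Set M.Num) ∧ P s ∧ StrLen s l ∧ n < l := by
  obtain ⟨b, D, h⟩ := exists_strBound K n
  obtain ⟨s, hlt, hs, hPs⟩ := hP (pair n (pair D b))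
  obtain ⟨l, hl⟩ := (hT s hs).1.1.1
  exact ⟨s, l, hs, hPs, hl, not_le.1 fun hle => (h.le (hT s hs).1 hl hle).not_gt hlt⟩

/-- The strings `s` and `t` have the same length and their entries satisfy `R`. -/
def Related (R : M.Num → M.Num → M.Num → M.Num → Prop) (s t : M.Num) : Prop :=
  ∃ l, StrLen s l ∧ StrLen t l ∧ ∀ i j u v, Entry s i u → Entry t j v → R i j u v

theorem Related.delta0 {R : M.Num → M.Num → M.Num → M.Num → Prop}
    (hR : Delta0 fun v => R (v 0) (v 1) (v 2) (v 3)) :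
    Delta0 fun v : ℕ → M.Num => Related R (v 0) (v 1) := by
  have : Delta0 fun v : ℕ → M.Num => R (v 3) (v 2) (v 1) (v 0) :=
    hR.comp₄ (.var 3) (.var 2) (.var 1) (.var 0)
  refine .congr (fun v => ∃ l, l < v 0 + 1 ∧ StrLen (v 0) l ∧ StrLen (v 1) l ∧
    ∀ i, i < v 0 + 1 → ∀ j, j < v 1 + 1 → ∀ u, u < v 0 + 1 → ∀ w, w < v 1 + 1 →
      Entry (v 0) i u → Entry (v 1) j w → R i j u w) fun v => ⟨?_, ?_⟩
  · rintro ⟨l, h, h', H⟩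
    exact ⟨l, lt_add_one_iff.2 h.le, h, h', fun i _ j _ u _ w _ => H i j u w⟩
  · rintro ⟨l, -, h, h', H⟩
    exact ⟨l, h, h', fun i j u w hu hw => H i (lt_add_one_iff.2 hu.index_le) j
      (lt_add_one_iff.2 hw.index_le) u (lt_add_one_iff.2 hu.value_le) w
      (lt_add_one_iff.2 hw.value_le) hu hw⟩

/-- The strings related to members of a tree form a tree. -/
theorem IsTree.exists_related (hT : IsTree K T) (J : M.Num)
    (R : M.Num → M.Num → M.Num → M.Num → Prop) (hR : Delta0 fun v => R (v 0) (v 1) (v 2) (v 3))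
    (hlong : ∀ n, ∃ s l, s ∈ (T : Set M.Num) ∧ StrLen s l ∧ n < l ∧
      ∀ i, i < l → ∃ u, u < J ∧ ∀ j v, Entry s j v → R i j u v) :
    ∃ S : M.sets, IsTree J S ∧ Infinite S ∧
      ∀ t, t ∈ (S : Set M.Num) → ∃ s, s ∈ (T : Set M.Num) ∧ Related R t s := by
  have hrel := Related.delta0 hR
  have h10 : Delta0 fun v : ℕ → M.Num => Related R (v 1) (v 0) := hrel.comp₂ (.var 1) (.var 0)
  have h40 : Delta0 fun v : ℕ → M.Num => Related R (v 4) (v 0) := hrel.comp₂ (.var 4) (.var 0)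
  -- Comprehension needs the complement to be $\Sigma^0_1$. A related `s` has the length of `t`, so
  -- the search for it stops at the code bound, and the complement only has to guess that bound.
  have hneg (t : M.Num) : ¬ (IsStrOver J t ∧ ∃ s, s ∈ (T : Set M.Num) ∧ Related R t s) ↔
      ¬ IsStrOver J t ∨ ∃ l b D, StrLen t l ∧ StrBound K l b D ∧
        ∀ s, s < pair l (pair D b) + 1 → ¬ (s ∈ (T : Set M.Num) ∧ Related R t s) := by
    rw [not_and_or]
    by_cases ht : IsStrOver J t
    · simp only [ht, not_true, false_or]
      constructor
      · intro H
        obtain ⟨l, hl⟩ := ht.1.1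
        obtain ⟨b, D, h⟩ := exists_strBound K l
        exact ⟨l, b, D, hl, h, fun s _ hs => H ⟨s, hs⟩⟩
      · rintro ⟨l, b, D, hl, h, H⟩ ⟨s, hs, hrel⟩
        obtain ⟨n, hn, hn', -⟩ := id hrel
        obtain rfl := hn.unique hl
        exact H s (lt_add_one_iff.2 (h.le (hT s hs).1 hn' le_rfl)) ⟨hs, hrel⟩
    · simp [ht]
  have : Sigma1 fun v : ℕ → M.Num =>
      ¬ (IsStrOver J (v 0) ∧ ∃ s, s ∈ (T : Set M.Num) ∧ Related R (v 0) s) := by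
    simp only [hneg, StrBound]
    infer_instance
  obtain ⟨S, hS⟩ := delta1_comprehension fun t =>
    IsStrOver J t ∧ ∃ s, s ∈ (T : Set M.Num) ∧ Related R t s
  refine ⟨S, fun t ht => ?_, fun n => ?_, fun t ht => ((hS t).1 ht).2⟩
  · obtain ⟨ht, s, hs, l, htl, hsl, H⟩ := (hS t).1 ht
    refine ⟨ht, fun t' ⟨ht', hpre⟩ => (hS t').2 ⟨⟨ht', fun i v h => ht.2 i v (hpre i v h)⟩, ?_⟩⟩
    obtain ⟨n, hn⟩ := ht'.1
    -- A prefix `t'` of `t` is related to the truncation `s'` of `s` to the length of `t'`, which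
    -- lies in `T`.
    have hnl : n ≤ l := not_lt.1 fun hlt => by
      obtain ⟨v, hv⟩ := hn.exists_entry hlt
      exact ((hpre l v hv).lt htl).false
    obtain ⟨s', hs', hs'n, hent⟩ := exists_isStr K n (fun i u => Entry s i u) fun i hi => by
      obtain ⟨v, hv⟩ := hsl.exists_entry (hi.trans_le hnl)
      exact ⟨v, hv, (hT s hs).1.2 i v hv⟩
    have hpre' : IsPre s' s := fun i v h => by
      obtain ⟨u, hu, hu'⟩ := hent i (h.lt hs'n)
      exact h.unique hu' ▸ hu.1
    exact ⟨s', (hT s hs).2 s' ⟨hs', hpre'⟩, n, hn, hs'n,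
      fun i j u v hu hv => H i j u v (hpre i u hu) (hpre' j v hv)⟩
  · obtain ⟨s, l, hs, hsl, hnl, H⟩ := hlong n
    have : Delta0 fun v : ℕ → M.Num => R (v 3) (v 1) (v 2) (v 0) :=
      hR.comp₄ (.var 3) (.var 1) (.var 2) (.var 0)
    have : Delta0 fun v : ℕ → M.Num => R (v 2) (v 1) (v 3) (v 0) :=
      hR.comp₄ (.var 2) (.var 1) (.var 3) (.var 0)
    -- A related string is built from an admissible color at each position; indices and entries are
    -- at most `s`, so admissibility is a bounded condition.
    obtain ⟨t, ht, htl, hent⟩ := exists_isStr J l (fun i u => ∀ j, j < s + 1 → ∀ v, v < s + 1 →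
      Entry s j v → R i j u v) fun i hi => by
        obtain ⟨u, hu, h⟩ := H i hi
        exact ⟨u, fun j _ v _ => h j v, hu⟩
    have hent' (i u : M.Num) (h : Entry t i u) : u < J ∧ ∀ j v, Entry s j v → R i j u v := by
      obtain ⟨w, hw, hw'⟩ := hent i (h.lt htl)
      obtain rfl := h.unique hw'
      exact ⟨hw.2, fun j v hv => hw.1 j (lt_add_one_iff.2 hv.index_le) v
        (lt_add_one_iff.2 hv.value_le) hv⟩
    exact ⟨t, hnl.trans_le htl.le, (hS t).2 ⟨⟨ht, fun i v h => (hent' i v h).1⟩, s, hs, l, htl, hsl,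
      fun i j u v hu => (hent' i u hu).2 j v⟩⟩

end Trees


open Number

/-! ### Semantics of the formulas about strings and trees -/

section Sat

set_option linter.unusedSectionVars false

variable {M : Model.{u}} [M.IsRCA0] {n m : ℕ} (v : Fin n → M.Num) (V : Fin m → M.sets)
  (k : ℕ) (s t i w : Term n)

theorem Term.val_numeral : (Term.numeral k : Term n).val M v = (k : M.Num) := by
  induction k with
  | zero => exact Nat.cast_zero.symm
  | succ k ih => rw [Nat.cast_succ, ← ih]; rfl

namespace Formula

theorem sat_hasLength : (hasLength s t).Sat M v V ↔ StrLen (s.val M v) (t.val M v) := by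
  simp only [hasLength, sat_ex, Sat, Term.val_up, Term.val, Term.pair]
  rfl

theorem sat_hasEntry :
    (hasEntry s i w).Sat M v V ↔ Entry (s.val M v) (i.val M v) (w.val M v) := by
  simp only [hasEntry, sat_ex, sat_and, Sat, Term.val_up, Term.val, Term.pair]
  rfl

theorem sat_sameString : (sameString s t).Sat M v V ↔ SameStr (s.val M v) (t.val M v) := by
  simp only [sameString, sat_ex, sat_and, sat_iff, sat_hasLength, sat_hasEntry, Sat, Term.val_up,
    Term.val]
  rfl

theorem sat_isString : (isString s).Sat M v V ↔ IsStr (s.val M v) := by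
  simp only [isString, sat_ex, sat_and, sat_allLt, sat_neg, sat_hasLength, sat_sameString,
    Term.val_up, Term.val]
  rfl

theorem sat_isStringOver : (isStringOver k s).Sat M v V ↔ IsStrOver (k : M.Num) (s.val M v) := by
  simp only [isStringOver, sat_and, sat_isString, sat_hasEntry, Sat, Term.val_up, Term.val,
    Term.val_numeral]
  rfl

theorem sat_isPrefix : (isPrefix t s).Sat M v V ↔ IsPre (t.val M v) (s.val M v) := by
  simp only [isPrefix, sat_hasEntry, Sat, Term.val_up, Term.val]
  rfl

theorem sat_isTree (T : Fin m) : (isTree k T : Formula n m).Sat M v V ↔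
    IsTree (k : M.Num) (V T) := by
  simp only [isTree, sat_and, sat_isString, sat_isStringOver, sat_isPrefix, Sat, Term.val]
  rfl

theorem sat_infinite (X : Fin m) : (infinite X : Formula n m).Sat M v V ↔ Infinite (V X) := by
  simp only [infinite, sat_and, sat_ex, Sat, Term.val]
  rfl

theorem sat_subset (H X : Fin m) :
    (subset H X : Formula n m).Sat M v V ↔ ∀ x, x ∈ (V H : Set M.Num) → x ∈ (V X : Set M.Num) :=
  Iff.rfl

theorem sat_homogeneousString (H : Fin m) : (homogeneousString k H s).Sat M v V ↔
    ∃ c, c < (k : M.Num) ∧ HomWith (V H) c (s.val M v) := by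
  simp only [homogeneousString, sat_exLt, sat_hasEntry, Sat, Term.val_up, Term.val,
    Term.val_numeral]
  rfl

end Formula

end Sat

section Statements

variable {M : Model.{u}}

/-- There are infinitely many members of `T` for which `H` is homogeneous. -/
def HomTree [M.IsRCA0] (k : ℕ) (H T : M.sets) : Prop :=
  ∀ x, ∃ s, x < s ∧ s ∈ (T : Set M.Num) ∧ ∃ c, c < (k : M.Num) ∧ HomWith H c s

variable [M.IsRCA0] {k : ℕ}

theorem Formula.sat_homogeneousTree {n m : ℕ} (v : Fin n → M.Num) (V : Fin m → M.sets)
    (H T : Fin m) : (homogeneousTree k H T : Formula n m).Sat M v V ↔ HomTree k (V H) (V T) := by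
  simp only [homogeneousTree, sat_and, sat_ex, sat_homogeneousString, Sat, Term.val]
  rfl

variable (M k)

theorem satisfies_RWKLk : M.Satisfies (RWKLk k) ↔ ∀ T : M.sets, IsTree (k : M.Num) T → Infinite T →
    ∃ H, Infinite H ∧ HomTree k H T := by
  simp only [Model.Satisfies, RWKLk, Formula.Sat, Formula.sat_and, Formula.sat_exSet,
    Formula.sat_isTree, Formula.sat_infinite, Formula.sat_homogeneousTree, and_imp]
  rfl

theorem satisfies_LRWKLk : M.Satisfies (LRWKLk k) ↔ ∀ T X : M.sets, IsTree (k : M.Num) T →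
    Infinite T → Infinite X → ∃ H : M.sets, Infinite H ∧
      (∀ x, x ∈ (H : Set M.Num) → x ∈ (X : Set M.Num)) ∧ HomTree k H T := by
  simp only [Model.Satisfies, LRWKLk, Formula.Sat, Formula.sat_and, Formula.sat_exSet,
    Formula.sat_isTree, Formula.sat_infinite, Formula.sat_homogeneousTree, Formula.sat_subset,
    and_imp]
  rfl

variable {M k}

/-! ### The equivalences -/

theorem rwkl_mono {j : ℕ} (hjk : j ≤ k) (hj : 0 < j) (h : M.Satisfies (RWKLk k)) :
    M.Satisfies (RWKLk j) := by
  rw [satisfies_RWKLk] at h ⊢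
  have hjk' : (j : M.Num) ≤ k := Nat.mono_cast hjk
  intro T hT hinf
  obtain ⟨H, hH, hom⟩ := h T (fun s hs => ⟨⟨(hT s hs).1.1, fun i v hv =>
    ((hT s hs).1.2 i v hv).trans_le hjk'⟩, (hT s hs).2⟩) hinf
  refine ⟨H, hH, fun x => ?_⟩
  obtain ⟨s, hxs, hs, c, -, hc⟩ := hom x
  refine ⟨s, hxs, hs, ?_⟩
  by_cases hcj : c < (j : M.Num)
  · exact ⟨c, hcj, hc⟩
  -- If `c ≥ j`, the string has no entry on `H` at all, so any color will do.
  · exact ⟨0, Nat.cast_pos.2 hj, fun i hi v hv =>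
      (hcj (hc i hi v hv ▸ (hT s hs).1.2 i v hv)).elim⟩

theorem rwkl_of_lrwkl (h : M.Satisfies (LRWKLk k)) : M.Satisfies (RWKLk k) := by
  rw [satisfies_LRWKLk] at h
  rw [satisfies_RWKLk]
  obtain ⟨X, hX⟩ := delta1_comprehension fun _ : M.Num => True
  intro T hT hinf
  obtain ⟨H, hH, -, hom⟩ := h T X hT hinf fun x =>
    ⟨x + 1, lt_add_one_iff.2 le_rfl, (hX _).2 trivial⟩
  exact ⟨H, hH, hom⟩

/-- To localize homogeneous sets to `X`, read the strings of the tree at the least member of `X`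
above each position. -/
theorem lrwkl_of_rwkl (h : M.Satisfies (RWKLk k)) : M.Satisfies (LRWKLk k) := by
  rw [satisfies_RWKLk] at h
  rw [satisfies_LRWKLk]
  intro T X hT hinf hX
  let Next (i x : M.Num) : Prop :=
    x ∈ (X : Set M.Num) ∧ i ≤ x ∧ ∀ y, y < x → i ≤ y → ¬ y ∈ (X : Set M.Num)
  have next_exists (i : M.Num) : ∃ x, Next i x := by
    obtain ⟨y, hiy, hy⟩ := hX i
    obtain ⟨x, -, ⟨hx, hix⟩, hmin⟩ := exists_least (fun x => x ∈ (X : Set M.Num) ∧ i ≤ x)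
      ⟨hy, hiy.le⟩
    exact ⟨x, hx, hix, fun y hy hiy hyX => hmin y hy ⟨hyX, hiy⟩⟩
  have next_unique {i x y : M.Num} (hx : Next i x) (hy : Next i y) : x = y := by
    obtain h | h | h := lt_trichotomy x y
    exacts [(hy.2.2 x h hx.2.1 hx.1).elim, h, (hx.2.2 y h hy.2.1 hy.1).elim]
  -- The new color at `i` is the old one at the next element of `X`.
  obtain ⟨S, hS, hSinf, hST⟩ := hT.exists_related k (fun i j u v => Next i j → u = v)
    (by infer_instance) fun n => by
      obtain ⟨s, l, hs, -, hl, hnl⟩ := hT.exists_long (fun _ => True)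
        (fun x => (hinf x).imp fun s hs => ⟨hs.1, hs.2, trivial⟩) n
      refine ⟨s, l, hs, hl, hnl, fun i hi => ?_⟩
      obtain ⟨x, hx⟩ := next_exists i
      by_cases hxl : x < l
      · obtain ⟨u, hu⟩ := hl.exists_entry hxl
        exact ⟨u, (hT s hs).1.2 x u hu, fun j v hv hj => hu.unique (next_unique hx hj ▸ hv)⟩
      · obtain ⟨u, hu⟩ := hl.exists_entry hi
        -- The next element lies beyond the string, so the color is free; the old entry at `i`
        -- serves as one below `k`.
        exact ⟨u, (hT s hs).1.2 i u hu, fun j v hv hj =>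
          (hxl (next_unique hx hj ▸ hv.lt hl)).elim⟩
  obtain ⟨H', hH', hom⟩ := h S hS hSinf
  -- The next element is never below `i`, so `i` can be bounded by `x`.
  obtain ⟨H, hH⟩ := delta1_comprehension fun x => ∃ i, i < x + 1 ∧ i ∈ (H' : Set M.Num) ∧ Next i x
  refine ⟨H, fun n => ?_, fun x hx => ?_, fun n => ?_⟩
  · obtain ⟨i, hni, hi⟩ := hH' n
    obtain ⟨x, hx⟩ := next_exists i
    exact ⟨x, hni.trans_le hx.2.1, (hH x).2 ⟨i, lt_add_one_iff.2 hx.2.1, hi, hx⟩⟩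
  · obtain ⟨i, -, -, hx⟩ := (hH x).1 hx
    exact hx.1
  · obtain ⟨t, l, ht, ⟨c, hc, hct⟩, htl, hnl⟩ := hS.exists_long _ hom n
    obtain ⟨s, hs, l', htl', hsl, hR⟩ := hST t ht
    obtain rfl := htl.unique htl'
    refine ⟨s, hnl.trans_le hsl.le, hs, c, hc, fun x hx v hv => ?_⟩
    obtain ⟨i, -, hi, hix⟩ := (hH x).1 hx
    obtain ⟨u, hu⟩ := htl.exists_entry (hix.2.1.trans_lt (hv.lt hsl))
    exact (hR i x u v hu hv hix).symm.trans (hct i hi u hu)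

/-- First decide where the color `k` is used; where it is not, `k` colors are left. -/
theorem lrwkl_succ (hk : 0 < k) (h₂ : M.Satisfies (LRWKLk 2)) (h : M.Satisfies (LRWKLk k)) :
    M.Satisfies (LRWKLk (k + 1)) := by
  rw [satisfies_LRWKLk] at h h₂ ⊢
  intro T X hT hinf hX
  have hk' : (k : M.Num) < ((k + 1 : ℕ) : M.Num) := Nat.cast_lt.2 k.lt_succ_self
  have h01 : (0 : M.Num) ≠ 1 := zero_ne_one
  obtain ⟨S, hS, hSinf, hST⟩ := hT.exists_related (2 : ℕ)
    (fun i j u v => i = j → (u = 1 ↔ v = (k : M.Num))) (by infer_instance) fun n => by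
      obtain ⟨s, l, hs, -, hl, hnl⟩ := hT.exists_long (fun _ => True)
        (fun x => (hinf x).imp fun s hs => ⟨hs.1, hs.2, trivial⟩) n
      refine ⟨s, l, hs, hl, hnl, fun i hi => ?_⟩
      obtain ⟨w, hw⟩ := hl.exists_entry hi
      by_cases hwk : w = k
      · refine ⟨1, by norm_num, ?_⟩
        rintro _ v hv rfl
        simp [← hw.unique hv, hwk]
      · refine ⟨0, by norm_num, ?_⟩
        rintro _ v hv rfl
        simp [← hw.unique hv, hwk]
  obtain ⟨H', hH', hsub', hom'⟩ := h₂ S X hS hSinf hX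
  -- If the color `1` serves infinitely many strings, `H'` is already homogeneous for `T` with color
  -- `k`. Otherwise, beyond some code only `0` can serve.
  by_cases hone : ∀ x, ∃ t, x < t ∧ t ∈ (S : Set M.Num) ∧ HomWith H' 1 t
  · refine ⟨H', hH', hsub', fun n => ?_⟩
    obtain ⟨t, l, ht, hom, htl, hnl⟩ := hS.exists_long _ hone n
    obtain ⟨s, hs, l', htl', hsl, hR⟩ := hST t ht
    obtain rfl := htl.unique htl'
    refine ⟨s, hnl.trans_le hsl.le, hs, k, hk', fun i hi v hv => ?_⟩
    obtain ⟨u, hu⟩ := htl.exists_entry (hv.lt hsl)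
    exact (hR i i u v hu hv rfl).1 (hom i hi u hu)
  have hzero : ∀ x, ∃ t, x < t ∧ t ∈ (S : Set M.Num) ∧ HomWith H' 0 t := by
    push Not at hone
    obtain ⟨y, hy⟩ := hone
    intro x
    obtain ⟨t, hxt, ht, c, hc, hom⟩ := hom' (max x y)
    have hc : c < 0 + 1 + 1 := by
      have : ((2 : ℕ) : M.Num) = 0 + 1 + 1 := by norm_num
      rwa [this] at hc
    obtain hc | rfl := (lt_add_one_iff.1 hc).lt_or_eq
    · obtain rfl : c = 0 := le_antisymm (lt_add_one_iff.1 hc) zero_le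
      exact ⟨t, (le_max_left _ _).trans_lt hxt, ht, hom⟩
    · exact (hy t ((le_max_right _ _).trans_lt hxt) ht (by rwa [zero_add] at hom)).elim
  -- Strings in `k` colors that agree on `H'` with a member of `T`. There are arbitrarily long ones,
  -- since arbitrarily long members of `T` avoid the color `k` on `H'`; off `H'` the entries are
  -- free, with `0` as filler.
  obtain ⟨S₂, hS₂, hS₂inf, hS₂T⟩ := hT.exists_related k
    (fun i j u v => i = j → i ∈ (H' : Set M.Num) → u = v) (by infer_instance) fun n => by
      obtain ⟨t, l, ht, hom, htl, hnl⟩ := hS.exists_long _ hzero n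
      obtain ⟨s, hs, l', htl', hsl, hR⟩ := hST t ht
      obtain rfl := htl.unique htl'
      refine ⟨s, l, hs, hsl, hnl, fun i hi => ?_⟩
      by_cases hiH : i ∈ (H' : Set M.Num)
      · obtain ⟨v, hv⟩ := hsl.exists_entry hi
        obtain ⟨u, hu⟩ := htl.exists_entry hi
        refine ⟨v, ?_, ?_⟩
        · have hvk := (hT s hs).1.2 i v hv
          rw [Nat.cast_succ, lt_add_one_iff] at hvk
          exact hvk.lt_of_ne fun e => h01
            ((hom i hiH u hu).symm.trans ((hR i i u v hu hv rfl).2 e))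
        · rintro _ w hw rfl -
          exact hv.unique hw
      · exact ⟨0, Nat.cast_pos.2 hk, fun j v _ _ hi => (hiH hi).elim⟩
  -- Here localization is essential: only inside `H'` do the strings of `S₂` say anything about `T`.
  obtain ⟨H, hH, hsub, hom⟩ := h S₂ H' hS₂ hS₂inf hH'
  refine ⟨H, hH, fun x hx => hsub' x (hsub x hx), fun n => ?_⟩
  obtain ⟨t, l, ht, ⟨c, hc, hct⟩, htl, hnl⟩ := hS₂.exists_long _ hom n
  obtain ⟨s, hs, l', htl', hsl, hR⟩ := hS₂T t ht
  obtain rfl := htl.unique htl'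
  refine ⟨s, hnl.trans_le hsl.le, hs, c, hc.trans hk', fun i hi v hv => ?_⟩
  obtain ⟨u, hu⟩ := htl.exists_entry (hv.lt hsl)
  exact (hR i i u v hu hv rfl (hsub i hi)).symm.trans (hct i hi u hu)

theorem lrwkl_of_lrwkl_two (hk : 2 ≤ k) (h : M.Satisfies (LRWKLk 2)) : M.Satisfies (LRWKLk k) :=
  Nat.le_induction h (fun _ hj ih => lrwkl_succ (by omega) h ih) k hk

theorem rwkl_iff_rwkl_two (hk : 2 ≤ k) : M.Satisfies (RWKLk k) ↔ M.Satisfies (RWKLk 2) :=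
  ⟨rwkl_mono hk two_pos, fun h => rwkl_of_lrwkl (lrwkl_of_lrwkl_two hk (lrwkl_of_rwkl h))⟩

theorem lrwkl_iff_rwkl : M.Satisfies (LRWKLk k) ↔ M.Satisfies (RWKLk k) :=
  ⟨rwkl_of_lrwkl, lrwkl_of_rwkl⟩

end Statements

end SecondOrderArithmetic

open SecondOrderArithmetic in
theorem mainTheorem7 (k : ℕ) (hk : 2 ≤ k) :
    ∀ φ ∈ [RWKL, LRWKL, RWKLk k, LRWKLk k], ∀ ψ ∈ [RWKL, LRWKL, RWKLk k, LRWKLk k],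
      Entails.{u} RCA0 (Formula.iff φ ψ) := by
  intro φ hφ ψ hψ M hM
  have : M.IsRCA0 := ⟨hM⟩
  have key : ∀ χ ∈ [RWKL, LRWKL, RWKLk k, LRWKLk k], (M.Satisfies χ ↔ M.Satisfies (RWKLk 2)) := by
    simp only [List.mem_cons, List.not_mem_nil, or_false]
    rintro χ (rfl | rfl | rfl | rfl)
    exacts [Iff.rfl, lrwkl_iff_rwkl, rwkl_iff_rwkl_two hk,
      lrwkl_iff_rwkl.trans (rwkl_iff_rwkl_two hk)]
  exact (Formula.sat_iff _ _ φ ψ).2 ((key φ hφ).trans (key ψ hψ).symm)
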